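/- **Conventions.** For a prime $p$ and a group $G$, the Quillen category $\mathscr{A}_p(G)$ has as objects the elementary abelian $p$-subgroups of $G$ (including the trivial subgroup); the morphisms $E \to F$ are the group homomorphisms of the form $x \mapsto gxg^{-1}$ for some $g \in G$ with $gEg^{-1} \subseteq F$. The lower central series is $\gamma_1(G) = G$, $\gamma_{i+1}(G) = [\gamma_i(G),G]$. **Theorem.** (1) Let $p$ be a prime, let $\theta$ be a root of the cyclotomic polynomial $\Phi_p$, and let $G_p = \mathbb{Z}_p[\theta] \rtimes C_p$, where a generator of $C_p$ acts on the additive group of $\mathbb{Z}_p[\theta]$ as multiplication by $\theta$. Then for all $i, i' \geq p+1$ the Quillen categories $\mathscr{A}_p(G_p/\gamma_i(G_p))$ and $\mathscr{A}_p(G_p/\gamma_{i'}(G_p))$ are equivalent. (2) Let $\theta$ be a root of $\Phi_9(X) = X^6+X^3+1$, let $\mathcal{O} = \mathbb{Z}_3[\theta]$ and $\mathfrak{p} = (\theta-1)\mathcal{O}$. For $r$ prime to $3$ let $\sigma_r$ be the $\mathbb{Z}_3$-algebra automorphism of $\mathcal{O}$ with $\sigma_r(\theta) = \theta^r$, and put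 $\gamma_0(x \wedge y) = \sigma_2(x)\sigma_{-1}(y) - \sigma_{-1}(x)\sigma_2(y)$. Let $j \geq 7$, let $c \in \mathcal{O}^\times$, put $\gamma = c\gamma_0$, and let $j \leq m \leq k$, where $k = 2j$ if $3 \mid j$ and $k = 2j-1$ otherwise. Write $T_\ell = \mathfrak{p}^{j-3+\ell}$ and $T = T_0$. Let $T_{j-3,\gamma,m}$ be the group with underlying set $T/T_m$ and product $$(x+T_m) * (y+T_m) = \left(x + y + \tfrac12 \gamma(x \wedge y)\right) + T_m ,$$ and let $R_{j-3,\gamma,m} = T_{j-3,\gamma,m} \rtimes C_9$ be the skeleton group (associated with $G_9 = \mathcal{O} \rtimes C_9$), where a generator of $C_9$ acts as multiplication by $\theta$. Then, up to equivalence of categories, the Quillen category $\mathscr{A}_3(R_{j-3,\gamma,m})$ is independent of $j$, $\gamma$ and $m$: for any two admissible triples $(j,c,m)$ and $(j',c',m')$ the Quillen categories of the corresponding skeleton groups are equivalent. -/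

import Mathlib

open CategoryTheory Polynomial

/-! ### The Quillen category -/

/-- Objects of the Quillen category of `G` at `p`: the elementary abelian `p`-subgroups of `G`
(including the trivial subgroup). -/
structure QuillenCat (p : ℕ) (G : Type) [Group G] where
  carrier : Subgroup G
  comm : ∀ x ∈ carrier, ∀ y ∈ carrier, x * y = y * x
  pow_eq_one : ∀ x ∈ carrier, x ^ p = 1

namespace QuillenCat

variable {p : ℕ} {G : Type} [Group G]

/-- Morphisms `E ⟶ F`: those group homomorphisms `E → F` which are restrictions of some
conjugation map `x ↦ g x g⁻¹` with `g ∈ G`. -/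
def Hom (E F : QuillenCat p G) : Type :=
  {f : E.carrier →* F.carrier // ∃ g : G, ∀ x : E.carrier, (f x : G) = g * (x : G) * g⁻¹}

instance : Category (QuillenCat p G) where
  Hom := Hom
  id E := ⟨MonoidHom.id E.carrier, 1, fun x => by simp⟩
  comp {E F K} f h := ⟨h.1.comp f.1, by
    obtain ⟨a, ha⟩ := f.2
    obtain ⟨b, hb⟩ := h.2
    exact ⟨b * a, fun x => by simp [ha, hb, mul_assoc]⟩⟩

end QuillenCat

/-! ### The ring `ℤ_p[θ]` -/

/-- `ℤ_p[θ]` with `θ` a root of the `n`-th cyclotomic polynomial. It is only used for `n` a power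
of `p`, where that polynomial is irreducible over `ℚ_p` and this is the ring of integers
of `ℚ_p(θ)`. -/
abbrev PadicCyc (p n : ℕ) [Fact p.Prime] : Type := AdjoinRoot (cyclotomic n ℤ_[p])

/-- The root of unity `θ`. -/
noncomputable def theta (p n : ℕ) [Fact p.Prime] : PadicCyc p n :=
  AdjoinRoot.root (cyclotomic n ℤ_[p])

theorem theta_pow (p n : ℕ) [Fact p.Prime] : theta p n ^ n = 1 := by
  have h : AdjoinRoot.mk (cyclotomic n ℤ_[p]) (X ^ n - 1) = 0 :=
    AdjoinRoot.mk_eq_zero.2 (cyclotomic.dvd_X_pow_sub_one n ℤ_[p])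
  rw [map_sub, map_pow, AdjoinRoot.mk_X, map_one] at h
  exact sub_eq_zero.1 h

/-- The homomorphism from the cyclic group `C_n = ⟨τ⟩` sending `τ` to `g`, when `g ^ n = 1`. -/
def cyclicLift {M : Type} [Monoid M] (n : ℕ) [NeZero n] (g : M) (hg : g ^ n = 1) :
    Multiplicative (ZMod n) →* M where
  toFun a := g ^ (Multiplicative.toAdd a).val
  map_one' := by simp
  map_mul' a b := by
    rw [toAdd_mul, ZMod.val_add, ← pow_add, ← pow_mod_orderOf g ((_ + _) % n),
      Nat.mod_mod_of_dvd _ (orderOf_dvd_of_pow_eq_one hg), pow_mod_orderOf]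

/-! ### The groups `G_p = ℤ_p[θ] ⋊ C_p` and their lower central quotients -/

/-- Multiplication by `θ` as an automorphism of the additive group of `ℤ_p[θ]`, `θ ^ p = 1`. -/
noncomputable def thetaAut (p : ℕ) [Fact p.Prime] : MulAut (Multiplicative (PadicCyc p p)) where
  toFun v := .ofAdd (theta p p * v.toAdd)
  invFun v := .ofAdd (theta p p ^ (p - 1) * v.toAdd)
  left_inv v := by
    beta_reduce
    rw [toAdd_ofAdd, ← mul_assoc, ← pow_succ, Nat.sub_add_cancel (Fact.out : p.Prime).one_le,
      theta_pow, one_mul, ofAdd_toAdd]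
  right_inv v := by
    beta_reduce
    rw [toAdd_ofAdd, ← mul_assoc, ← pow_succ', Nat.sub_add_cancel (Fact.out : p.Prime).one_le,
      theta_pow, one_mul, ofAdd_toAdd]
  map_mul' v w := by rw [toAdd_mul, mul_add, ofAdd_add]

theorem thetaAut_pow_apply (p : ℕ) [Fact p.Prime] (k : ℕ) (v : Multiplicative (PadicCyc p p)) :
    (thetaAut p ^ k) v = .ofAdd (theta p p ^ k * v.toAdd) := by
  induction k with
  | zero => simp
  | succ k ih =>
    rw [pow_succ', MulAut.mul_apply, ih]
    change Multiplicative.ofAdd (theta p p * (theta p p ^ k * v.toAdd)) = _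
    rw [← mul_assoc, ← pow_succ']

theorem thetaAut_pow (p : ℕ) [Fact p.Prime] : thetaAut p ^ p = 1 := by
  ext v
  rw [thetaAut_pow_apply, theta_pow, one_mul]; rfl

/-- The pro-`p`-group `G_p = ℤ_p[θ] ⋊ C_p`, where the generator `τ` of `C_p` acts on `ℤ_p[θ]` as
multiplication by `θ`. -/
abbrev MaxClassGroup (p : ℕ) [Fact p.Prime] : Type :=
  Multiplicative (PadicCyc p p) ⋊[cyclicLift p (thetaAut p) (thetaAut_pow p)]
    Multiplicative (ZMod p)

/-- The quotient `G_p / γ_i(G_p)`, where `γ_1(G) = G` and `γ_{i+1}(G) = [γ_i(G), G]`; Mathlib's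
lower central series starts with index `0`. -/
abbrev MainLineQuotient (p : ℕ) [Fact p.Prime] (i : ℕ) : Type :=
  MaxClassGroup p ⧸ (⊤ : Subgroup (MaxClassGroup p)).lowerCentralSeries (i - 1)

/-! ### The ring `𝒪 = ℤ_3[θ]` with `θ` a primitive ninth root of unity -/

namespace Skeleton

/-- `𝒪 = ℤ_3[θ]`, where `θ` is a root of `Φ_9 = X ^ 6 + X ^ 3 + 1`. -/
abbrev 𝒪 : Type := PadicCyc 3 9

/-- `θ ∈ 𝒪`. -/
noncomputable abbrev θ : 𝒪 := theta 3 9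

/-- The maximal ideal `𝔭 = (θ - 1)𝒪`. -/
noncomputable def 𝔭 : Ideal 𝒪 := Ideal.span {θ - 1}

theorem cyclotomic_nine : cyclotomic 9 ℤ_[3] = X ^ 6 + X ^ 3 + 1 := by
  have h : cyclotomic (3 ^ (1 + 1)) ℤ_[3] = ∑ i ∈ Finset.range 3, (X ^ 3 ^ 1) ^ i :=
    cyclotomic_prime_pow_eq_geom_sum Nat.prime_three
  norm_num [Finset.sum_range_succ] at h
  rw [h]; ring

theorem theta_rel : θ ^ 6 + θ ^ 3 + 1 = 0 := by
  have h : AdjoinRoot.mk (cyclotomic 9 ℤ_[3]) (X ^ 6 + X ^ 3 + 1) = 0 :=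
    AdjoinRoot.mk_eq_zero.2 (dvd_of_eq cyclotomic_nine)
  rw [map_add, map_add, map_pow, map_pow, AdjoinRoot.mk_X, map_one] at h
  exact h

theorem sigma_aux (r : ℕ) (hr : r.Coprime 3) :
    (cyclotomic 9 ℤ_[3]).eval₂ (Algebra.ofId ℤ_[3] 𝒪 : ℤ_[3] →+* 𝒪) (θ ^ r) = 0 := by
  have h9 : θ ^ 9 = 1 := theta_pow 3 9
  have hrel := theta_rel
  generalize (Algebra.ofId ℤ_[3] 𝒪 : ℤ_[3] →+* 𝒪) = f
  have hc := congrArg (fun q => q.eval₂ f (θ ^ r)) cyclotomic_nine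
  refine hc.trans ?_
  simp only [eval₂_add, eval₂_pow, eval₂_X, eval₂_one]
  have h3 : ¬ 3 ∣ r := fun h => by
    have := Nat.dvd_gcd h dvd_rfl
    rw [hr] at this; omega
  rcases (by omega : r % 3 = 1 ∨ r % 3 = 2) with h | h
  · obtain ⟨q, rfl⟩ : ∃ q, r = 3 * q + 1 := ⟨r / 3, by omega⟩
    calc _ = (θ ^ 9) ^ (2 * q) * θ ^ 6 + (θ ^ 9) ^ q * θ ^ 3 + 1 := by ring
      _ = 0 := by rw [h9, one_pow, one_pow, one_mul, one_mul, hrel]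
  · obtain ⟨q, rfl⟩ : ∃ q, r = 3 * q + 2 := ⟨r / 3, by omega⟩
    calc _ = (θ ^ 9) ^ (2 * q + 1) * θ ^ 3 + (θ ^ 9) ^ q * θ ^ 6 + 1 := by ring
      _ = 0 := by rw [h9, one_pow, one_pow, one_mul, one_mul, add_comm (θ ^ 3), hrel]

/-- The Galois automorphism `σ_r` of `𝒪`, for `r` prime to `3`: the `ℤ_3`-algebra homomorphism with
`σ_r(θ) = θ ^ r`. -/
noncomputable def σ (r : ℕ) (hr : r.Coprime 3) : 𝒪 →ₐ[ℤ_[3]] 𝒪 :=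
  AdjoinRoot.liftAlgHom _ (Algebra.ofId ℤ_[3] 𝒪) (θ ^ r) (sigma_aux r hr)

theorem σ_theta (r : ℕ) (hr : r.Coprime 3) : σ r hr θ = θ ^ r :=
  AdjoinRoot.liftAlgHom_root _ _ _ _

/-- `σ_2`. -/
noncomputable abbrev σ₂ : 𝒪 →ₐ[ℤ_[3]] 𝒪 := σ 2 (by decide)

/-- `σ_{-1}`; note that `θ⁻¹ = θ ^ 8`. -/
noncomputable abbrev σm : 𝒪 →ₐ[ℤ_[3]] 𝒪 := σ 8 (by decide)

/-- The twisting map `γ_0(x ∧ y) = σ_2(x) σ_{-1}(y) - σ_{-1}(x) σ_2(y)`. -/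
noncomputable def γ₀ (x y : 𝒪) : 𝒪 := σ₂ x * σm y - σm x * σ₂ y

/-- `1/2 ∈ 𝒪`. -/
noncomputable def half : 𝒪 := Ring.inverse 2

theorem two_mul_half : 2 * half = 1 := by
  have h : IsUnit (2 : ℤ_[3]) := by
    rw [PadicInt.isUnit_iff]
    exact_mod_cast (PadicInt.norm_natCast_eq_one_iff (p := 3) (n := 2)).2 (by decide)
  have h2 : IsUnit (2 : 𝒪) := by
    have := h.map (algebraMap ℤ_[3] 𝒪)
    rwa [map_ofNat] at this
  exact Ring.mul_inverse_cancel _ h2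

/-! The valuation estimates needed for the product below to be well defined and associative. -/

theorem pi_mem : θ - 1 ∈ 𝔭 := Ideal.mem_span_singleton_self _

theorem three_mem : (3 : 𝒪) ∈ 𝔭 ^ 3 := by
  have key : (3 : 𝒪) = (θ - 1) * (-(θ - 1) ^ 5 -
      3 * (2 * (θ - 1) ^ 4 + 5 * (θ - 1) ^ 3 + 7 * (θ - 1) ^ 2 + 6 * (θ - 1) + 3)) := by
    linear_combination theta_rel
  have step : ∀ k < 3, (3 : 𝒪) ∈ 𝔭 ^ k → (3 : 𝒪) ∈ 𝔭 ^ (k + 1) := by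
    intro k hk h
    rw [key, pow_succ', ]
    refine Ideal.mul_mem_mul pi_mem (Ideal.sub_mem _ (neg_mem ?_) (Ideal.mul_mem_right _ _ h))
    exact Ideal.pow_le_pow_right (by omega) (Ideal.pow_mem_pow pi_mem 5)
  exact step 2 (by omega) (step 1 (by omega) (step 0 (by omega) (by simp)))

theorem sub_mem_two : (θ + 1) - (-θ ^ 8) ∈ 𝔭 ^ 2 := by
  have h9 : θ ^ 9 = 1 := theta_pow 3 9
  have : (θ + 1) - (-θ ^ 8) = θ ^ 8 * ((θ - 1) ^ 2 + 3 * θ) := by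
    linear_combination (-θ - 1) * h9
  rw [this]
  exact Ideal.mul_mem_left _ _ (Ideal.add_mem _ (Ideal.pow_mem_pow pi_mem 2)
    (Ideal.mul_mem_right _ _ (Ideal.pow_le_pow_right (by omega) three_mem)))

theorem theta_cube_mem : θ ^ 3 - 1 ∈ 𝔭 ^ 3 := by
  have : θ ^ 3 - 1 = (θ - 1) ^ 3 + 3 * (θ * (θ - 1)) := by ring
  rw [this]
  exact Ideal.add_mem _ (Ideal.pow_mem_pow pi_mem 3) (Ideal.mul_mem_right _ _ three_mem)

theorem σ_sub_mem (u : 𝒪) : σ₂ u - σm u ∈ 𝔭 ^ 3 := by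
  have h : (Ideal.Quotient.mkₐ ℤ_[3] (𝔭 ^ 3)).comp σ₂ =
      (Ideal.Quotient.mkₐ ℤ_[3] (𝔭 ^ 3)).comp σm := by
    apply AdjoinRoot.algHom_ext
    change Ideal.Quotient.mk (𝔭 ^ 3) (σ₂ θ) = Ideal.Quotient.mk (𝔭 ^ 3) (σm θ)
    rw [Ideal.Quotient.eq, σ_theta, σ_theta]
    have : θ ^ 2 - θ ^ 8 = (θ ^ 3 - 1) * (-θ ^ 2 * (θ ^ 3 + 1)) := by ring
    rw [this]
    exact Ideal.mul_mem_right _ _ theta_cube_mem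
  exact (Ideal.Quotient.eq).1 (DFunLike.congr_fun h u)

theorem mem_pow_iff {k : ℕ} {x : 𝒪} : x ∈ 𝔭 ^ k ↔ ∃ u, x = (θ - 1) ^ k * u := by
  rw [𝔭, Ideal.span_singleton_pow, Ideal.mem_span_singleton]; rfl

theorem γ₀_expand (i j : ℕ) (u w : 𝒪) :
    γ₀ ((θ - 1) ^ i * u) ((θ - 1) ^ j * w) = (θ - 1) ^ (i + j) *
      ((θ + 1) ^ i * (-θ ^ 8) ^ j * (σ₂ u * σm w) -
        (-θ ^ 8) ^ i * (θ + 1) ^ j * (σm u * σ₂ w)) := by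
  have h9 : θ ^ 9 = 1 := theta_pow 3 9
  have h2 : σ₂ (θ - 1) = (θ - 1) * (θ + 1) := by
    rw [map_sub, map_one, σ_theta]; ring
  have h8 : σm (θ - 1) = (θ - 1) * (-θ ^ 8) := by
    rw [map_sub, map_one, σ_theta]; linear_combination h9
  simp only [γ₀, map_mul, map_pow, h2, h8, mul_pow]
  ring

theorem γ₀_mem {i j : ℕ} {x y : 𝒪} (hx : x ∈ 𝔭 ^ i) (hy : y ∈ 𝔭 ^ j) :
    γ₀ x y ∈ 𝔭 ^ (i + j + 2) := by
  obtain ⟨u, rfl⟩ := mem_pow_iff.1 hx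
  obtain ⟨w, rfl⟩ := mem_pow_iff.1 hy
  rw [γ₀_expand, pow_add 𝔭 (i + j)]
  refine Ideal.mul_mem_mul (Ideal.pow_mem_pow pi_mem _) ?_
  have hσ : ∀ u, Ideal.Quotient.mk (𝔭 ^ 2) (σ₂ u) = Ideal.Quotient.mk (𝔭 ^ 2) (σm u) :=
    fun u => Ideal.Quotient.eq.2 (Ideal.pow_le_pow_right (by omega) (σ_sub_mem u))
  have hab : Ideal.Quotient.mk (𝔭 ^ 2) (θ + 1) = Ideal.Quotient.mk (𝔭 ^ 2) (-θ ^ 8) :=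
    Ideal.Quotient.eq.2 sub_mem_two
  rw [← Ideal.Quotient.eq_zero_iff_mem, map_sub, map_mul, map_mul, map_mul, map_mul, map_mul,
    map_mul, map_pow, map_pow, map_pow, map_pow, hab, hσ, hσ, sub_self]

theorem γ₀_mem' {i j : ℕ} (hij : i % 3 = j % 3) {x y : 𝒪} (hx : x ∈ 𝔭 ^ i) (hy : y ∈ 𝔭 ^ j) :
    γ₀ x y ∈ 𝔭 ^ (i + j + 3) := by
  obtain ⟨u, rfl⟩ := mem_pow_iff.1 hx
  obtain ⟨w, rfl⟩ := mem_pow_iff.1 hy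
  rw [γ₀_expand, pow_add 𝔭 (i + j)]
  refine Ideal.mul_mem_mul (Ideal.pow_mem_pow pi_mem _) ?_
  have hσ : ∀ u, Ideal.Quotient.mk (𝔭 ^ 3) (σ₂ u) = Ideal.Quotient.mk (𝔭 ^ 3) (σm u) :=
    fun u => Ideal.Quotient.eq.2 (σ_sub_mem u)
  set a : 𝒪 := θ + 1 with ha
  set b : 𝒪 := -θ ^ 8 with hb
  have hab : Ideal.Quotient.mk (𝔭 ^ 3) a ^ 3 = Ideal.Quotient.mk (𝔭 ^ 3) b ^ 3 := by
    rw [← map_pow, ← map_pow, Ideal.Quotient.eq]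
    have : a ^ 3 - b ^ 3 = (a - b) ^ 2 * (a - b) + 3 * (a * b * (a - b)) := by ring
    rw [this]
    refine Ideal.add_mem _ (Ideal.pow_le_pow_right (show 3 ≤ 2 * 2 + 2 by omega) ?_)
      (Ideal.mul_mem_right _ _ three_mem)
    rw [pow_add, pow_mul]
    exact Ideal.mul_mem_mul (Ideal.pow_mem_pow sub_mem_two 2) sub_mem_two
  have key : Ideal.Quotient.mk (𝔭 ^ 3) a ^ i * Ideal.Quotient.mk (𝔭 ^ 3) b ^ j =
      Ideal.Quotient.mk (𝔭 ^ 3) b ^ i * Ideal.Quotient.mk (𝔭 ^ 3) a ^ j := by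
    generalize Ideal.Quotient.mk (𝔭 ^ 3) a = A at *
    generalize Ideal.Quotient.mk (𝔭 ^ 3) b = B at *
    rw [← Nat.div_add_mod i 3, ← Nat.div_add_mod j 3, hij]
    simp only [pow_add, pow_mul, hab]
    ring
  rw [← Ideal.Quotient.eq_zero_iff_mem, map_sub, map_mul, map_mul, map_mul, map_mul, map_mul,
    map_mul, map_pow, map_pow, map_pow, map_pow, hσ, hσ, key, sub_self]

/-! ### The skeleton groups -/

/-- The parameters `j, m, c` of a skeleton group: `j ≥ 7`; `c` is a unit of `𝒪`; and
`j ≤ m ≤ k`, where `k = 2j` if `3 ∣ j` and `k = 2j - 1` otherwise. -/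
structure Param where
  j : ℕ
  m : ℕ
  c : 𝒪ˣ
  seven_le : 7 ≤ j
  j_le : j ≤ m
  m_le : m ≤ if 3 ∣ j then 2 * j else 2 * j - 1

variable (d : Param)

/-- `T_ℓ = 𝔭 ^ (j - 3 + ℓ)`, and `T = T_0`. -/
noncomputable abbrev Param.T (ℓ : ℕ) : Ideal 𝒪 := 𝔭 ^ (d.j - 3 + ℓ)

/-- The twisting map `γ = c γ_0`. -/
noncomputable def Param.γ (x y : 𝒪) : 𝒪 := d.c * γ₀ x y

variable {d}

theorem γ_mem {x y : 𝒪} (hx : x ∈ d.T 0) (hy : y ∈ d.T 0) : d.γ x y ∈ d.T d.j := by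
  have h := d.seven_le
  exact Ideal.mul_mem_left _ _ (Ideal.pow_le_pow_right (by omega) (γ₀_mem' rfl hx hy))

theorem γ_mem_left {x y : 𝒪} (hx : x ∈ d.T d.m) (hy : y ∈ d.T 0) : d.γ x y ∈ d.T d.m := by
  have h := d.seven_le
  exact Ideal.mul_mem_left _ _ (Ideal.pow_le_pow_right (by omega) (γ₀_mem hx hy))

theorem γ_mem_right {x y : 𝒪} (hx : x ∈ d.T 0) (hy : y ∈ d.T d.m) : d.γ x y ∈ d.T d.m := by
  have h := d.seven_le
  exact Ideal.mul_mem_left _ _ (Ideal.pow_le_pow_right (by omega) (γ₀_mem hx hy))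

theorem γ_swap (x y : 𝒪) : d.γ y x = - d.γ x y := by
  simp only [Param.γ, γ₀]; ring

theorem γ_nest {x y : 𝒪} (hx : x ∈ d.T d.j) (hy : y ∈ d.T 0) : d.γ x y ∈ d.T d.m := by
  have h := d.seven_le
  have hm := d.m_le
  by_cases h3 : 3 ∣ d.j
  · rw [if_pos h3] at hm
    exact Ideal.mul_mem_left _ _ (Ideal.pow_le_pow_right (by omega)
      (γ₀_mem' (by omega) hx hy))
  · rw [if_neg h3] at hm
    exact Ideal.mul_mem_left _ _ (Ideal.pow_le_pow_right (by omega) (γ₀_mem hx hy))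

theorem γ_add_left (x y z : 𝒪) : d.γ (x + y) z = d.γ x z + d.γ y z := by
  simp only [Param.γ, γ₀, map_add]; ring

theorem γ_add_right (x y z : 𝒪) : d.γ x (y + z) = d.γ x y + d.γ x z := by
  simp only [Param.γ, γ₀, map_add]; ring

theorem γ_self (x : 𝒪) : d.γ x x = 0 := by
  simp only [Param.γ, γ₀]; ring

theorem γ_neg_left (x y : 𝒪) : d.γ (-x) y = - d.γ x y := by
  simp only [Param.γ, γ₀, map_neg]; ring

theorem γ_theta (x y : 𝒪) : d.γ (θ * x) (θ * y) = θ * d.γ x y := by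
  have h9 : θ ^ 9 = 1 := theta_pow 3 9
  simp only [Param.γ, γ₀, map_mul, σ_theta]
  linear_combination (θ * d.c * (σ₂ x * σm y - σm x * σ₂ y)) * h9

theorem σ_half (r : ℕ) (hr : r.Coprime 3) : σ r hr half = half := by
  have h : 2 * σ r hr half = 1 := by
    rw [← map_ofNat (σ r hr) 2, ← map_mul, two_mul_half, map_one]
  linear_combination half * h - σ r hr half * two_mul_half

theorem γ_half_left (x y : 𝒪) : d.γ (half * x) y = half * d.γ x y := by
  simp only [Param.γ, γ₀, map_mul, σ_half]; ring

theorem γ_half_right (x y : 𝒪) : d.γ x (half * y) = half * d.γ x y := by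
  simp only [Param.γ, γ₀, map_mul, σ_half]; ring

theorem half_γ_mem (x y : d.T 0) : half * d.γ x y ∈ d.T 0 :=
  Ideal.mul_mem_left _ _ (Ideal.pow_le_pow_right (by omega) (γ_mem x.2 y.2))

/-- The product `x * y = x + y + ½ γ(x ∧ y)` on `T`, before reduction modulo `T_m`. -/
noncomputable def preMul (x y : d.T 0) : d.T 0 := x + y + ⟨half * d.γ x y, half_γ_mem x y⟩

variable (d)

/-- The additive group `T / T_m`. -/
abbrev QuotT : Type := d.T 0 ⧸ (d.T d.m).submoduleOf (d.T 0)

variable {d}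

theorem quotT_eq {x y : d.T 0} :
    (Submodule.Quotient.mk x : QuotT d) = Submodule.Quotient.mk y ↔ (x - y : 𝒪) ∈ d.T d.m := by
  rw [Submodule.Quotient.eq]; rfl

theorem preMul_congr {x x' y y' : d.T 0} (hx : (x - x' : 𝒪) ∈ d.T d.m)
    (hy : (y - y' : 𝒪) ∈ d.T d.m) :
    (preMul x y - preMul x' y' : 𝒪) ∈ d.T d.m := by
  have h1 := γ_mem_left hx y.2
  have h2 := γ_mem_right x'.2 hy
  have : (preMul x y - preMul x' y' : 𝒪) = (x - x') + (y - y') +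
      half * (d.γ (x - x') y + d.γ x' (y - y')) := by
    change ((x : 𝒪) + y + half * d.γ x y) - (x' + y' + half * d.γ x' y') = _
    rw [sub_eq_add_neg (x : 𝒪), sub_eq_add_neg (y : 𝒪), γ_add_left, γ_add_right, γ_neg_left,
      γ_swap (-(y' : 𝒪)) x', γ_neg_left, γ_swap (x' : 𝒪) y']
    ring
  rw [this]
  exact Ideal.add_mem _ (Ideal.add_mem _ hx hy) (Ideal.mul_mem_left _ _ (Ideal.add_mem _ h1 h2))

variable (d)

/-- The group `T_{j-3,γ,m}`: its underlying set is `T / T_m`. -/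
@[ext]
structure TwistedT where
  toQuot : QuotT d

variable {d}

namespace TwistedT

/-- The class `x + T_m` of `x ∈ T`. -/
noncomputable def cls (x : d.T 0) : TwistedT d := ⟨Submodule.Quotient.mk x⟩

theorem cls_surj (a : TwistedT d) : ∃ x, a = cls x := by
  obtain ⟨a⟩ := a
  obtain ⟨x, rfl⟩ := Submodule.Quotient.mk_surjective _ a
  exact ⟨x, rfl⟩

theorem cls_eq {x y : d.T 0} : cls x = cls y ↔ (x - y : 𝒪) ∈ d.T d.m := by
  rw [← quotT_eq, TwistedT.ext_iff]; rfl

/-- `(x + T_m) * (y + T_m) = (x + y + ½ γ(x ∧ y)) + T_m`. -/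
noncomputable instance : Mul (TwistedT d) where
  mul a b := ⟨Quotient.map₂ preMul (fun x x' hx y y' hy => by
    have hx' := quotT_eq.1 (Quotient.sound hx)
    have hy' := quotT_eq.1 (Quotient.sound hy)
    exact Quotient.exact (quotT_eq.2 (preMul_congr hx' hy'))) a.toQuot b.toQuot⟩

theorem cls_mul (x y : d.T 0) : cls x * cls y = cls (preMul x y) := rfl

noncomputable instance : Group (TwistedT d) :=
  letI : One (TwistedT d) := ⟨cls 0⟩
  letI : Inv (TwistedT d) := ⟨fun a => ⟨-a.toQuot⟩⟩
  Group.ofLeftAxioms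
    (by
      intro a b c
      obtain ⟨x, rfl⟩ := cls_surj a
      obtain ⟨y, rfl⟩ := cls_surj b
      obtain ⟨z, rfl⟩ := cls_surj c
      rw [cls_mul, cls_mul, cls_mul, cls_mul, cls_eq]
      have h1 := γ_nest (γ_mem x.2 y.2) z.2
      have h2 := γ_nest (γ_mem y.2 z.2) x.2
      have : (preMul (preMul x y) z - preMul x (preMul y z) : 𝒪) =
          half * (half * (d.γ (d.γ x y) z + d.γ (d.γ y z) x)) := by
        change ((x : 𝒪) + y + half * d.γ x y) + z + half * d.γ (x + y + half * d.γ x y) z -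
          (x + (y + z + half * d.γ y z) + half * d.γ x (y + z + half * d.γ y z)) = _
        rw [γ_add_left, γ_add_left, γ_half_left, γ_add_right, γ_add_right, γ_half_right,
          γ_swap (d.γ (y : 𝒪) z) x]
        ring
      rw [this]
      exact Ideal.mul_mem_left _ _ (Ideal.mul_mem_left _ _ (Ideal.add_mem _ h1 h2)))
    (by
      intro a
      obtain ⟨x, rfl⟩ := cls_surj a
      change cls 0 * cls x = cls x
      rw [cls_mul]
      congr 1
      ext
      change (0 : 𝒪) + x + half * d.γ 0 x = x
      have : d.γ 0 (x : 𝒪) = 0 := by simp [Param.γ, γ₀]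
      rw [this]; ring)
    (by
      intro a
      obtain ⟨x, rfl⟩ := cls_surj a
      change cls (-x) * cls x = cls 0
      rw [cls_mul]
      congr 1
      ext
      change (-x : 𝒪) + x + half * d.γ (-x) x = 0
      rw [γ_neg_left, γ_self]; ring)

/-- Multiplication by `θ ^ k` on `T / T_m`. -/
noncomputable def thetaMap (k : ℕ) (a : TwistedT d) : TwistedT d := ⟨θ ^ k • a.toQuot⟩

theorem thetaMap_thetaMap {k l : ℕ} (h : k + l = 9) (a : TwistedT d) :
    thetaMap k (thetaMap l a) = a := by
  have h9 : θ ^ 9 = 1 := theta_pow 3 9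
  ext
  change θ ^ k • θ ^ l • a.toQuot = a.toQuot
  rw [smul_smul, ← pow_add, h, h9, one_smul]

variable (d)

/-- The automorphism `v + T_m ↦ θ v + T_m` of `T_{j-3,γ,m}`. -/
noncomputable def thetaAut : MulAut (TwistedT d) where
  toFun := thetaMap 1
  invFun := thetaMap 8
  left_inv := thetaMap_thetaMap rfl
  right_inv := thetaMap_thetaMap rfl
  map_mul' a b := by
    obtain ⟨x, rfl⟩ := cls_surj a
    obtain ⟨y, rfl⟩ := cls_surj b
    change cls (θ ^ 1 • preMul x y) = cls (preMul (θ ^ 1 • x) (θ ^ 1 • y))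
    congr 1
    ext
    change θ ^ 1 * ((x : 𝒪) + y + half * d.γ x y) =
      θ ^ 1 * x + θ ^ 1 * y + half * d.γ (θ ^ 1 * x) (θ ^ 1 * y)
    rw [pow_one, γ_theta]; ring

theorem thetaAut_pow : thetaAut d ^ 9 = 1 := by
  have h9 : θ ^ 9 = 1 := theta_pow 3 9
  have h : ∀ (k : ℕ) (a : TwistedT d), (thetaAut d ^ k) a = thetaMap k a := by
    intro k a
    induction k with
    | zero => ext; change a.toQuot = θ ^ 0 • a.toQuot; rw [pow_zero, one_smul]
    | succ k ih =>
      rw [pow_succ', MulAut.mul_apply, ih]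
      ext
      change θ ^ 1 • θ ^ k • a.toQuot = θ ^ (k + 1) • a.toQuot
      rw [smul_smul, ← pow_add, add_comm]
  apply MulEquiv.ext
  intro a
  rw [h]
  ext
  change θ ^ 9 • a.toQuot = a.toQuot
  rw [h9, one_smul]

end TwistedT

variable (d)

/-- The skeleton group `R_{j-3,γ,m} = T_{j-3,γ,m} ⋊ C`, where `C = ⟨τ⟩` is cyclic of order `9` and
`τ` acts as multiplication by `θ`. -/
abbrev SkeletonGroup : Type :=
  TwistedT d ⋊[cyclicLift 9 (TwistedT.thetaAut d) (TwistedT.thetaAut_pow d)]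
    Multiplicative (ZMod 9)

end Skeleton

/-! Write π = θ - 1 and ω = θ ^ M. Every group in the theorem is an extension, by a cyclic group ⟨τ⟩
of order N = pM, of a kernel K with underlying set R / π ^ m, whose product is addition perturbed by
a small alternating biadditive map β. The Quillen category sees neither m nor β: it is equivalent to
a category `QuillenModel` built from p, M, e and θ alone, where p is associated to π ^ e and ω - 1
to π ^ M.

The elements of K of order dividing p form π ^ (m - e) R / π ^ m, a copy of R / π ^ e. There β
vanishes and K acts trivially, while τ acts as θ (`om_add`, `exists_om`, `conj_om`). An element of
order p outside K has its image in the subgroup of order p generated by τ ^ M, so a suitable power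
of it is v τ ^ M for some v. Conversely each v τ ^ M has order p, because 1 + ω + ... + ω ^ (p - 1)
= 0 and β vanishes on multiples of v by powers of ω (`s_pow`). It centralizes exactly the part of R
/ π ^ e killed by π ^ M (`om_commute_s_iff`). Hence an elementary abelian subgroup either lies in R
/ π ^ e, or is given by some v and a subgroup of 𝔽_p times that annihilator.

For fusion, conjugation by K moves v by a displacement which is (1 - ω)x up to a β-term of higher
order, so successive approximation reaches all of π ^ M R (`exists_disp`). Thus only v modulo π ^ M
matters, up to the action of τ. The annihilator sits in π ^ (m - M) R, which is contained in π ^ M R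
since 2M ≤ m, so translating v by it changes nothing. This makes the morphisms independent of m and
β (`isConj_of_conj`, `exists_conj`).

What remains is to produce such coordinates for both families. -/

/-- The properties of `θ ∈ ℤ_p[θ]`, a primitive `N`-th root of unity with `N = p * M` a power
of `p`, which determine the elementary abelian subgroups of the groups below. -/
structure IsRamifiedRoot (p M N e : ℕ) {R : Type} [CommRing R] (θ : R) : Prop where
  N_eq : N = p * M
  M_pos : 0 < M
  M_le_e : M ≤ e
  pow_N : θ ^ N = 1
  regular : ∀ x, (θ - 1) * x = 0 → x = 0
  prime_dvd : (p : R) ∣ (θ - 1) ^ e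
  dvd_prime : (θ - 1) ^ e ∣ (p : R)
  dvd_omega : (θ - 1) ^ M ∣ θ ^ M - 1
  omega_dvd : θ ^ M - 1 ∣ (θ - 1) ^ M
  geom_sum : ∑ i ∈ Finset.range p, (θ ^ M) ^ i = 0

theorem IsRamifiedRoot.pow_regular {p M N e : ℕ} {R : Type} [CommRing R] {θ : R}
    (h : IsRamifiedRoot p M N e θ) (k : ℕ) {x : R} (hx : (θ - 1) ^ k * x = 0) : x = 0 := by
  induction k with
  | zero => simpa using hx
  | succ k ih => exact ih (h.regular _ (by rw [← hx]; ring))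

theorem IsRamifiedRoot.pow_dvd_cancel {p M N e : ℕ} {R : Type} [CommRing R] {θ : R}
    (h : IsRamifiedRoot p M N e θ) (k l : ℕ) {x : R}
    (hx : (θ - 1) ^ (k + l) ∣ (θ - 1) ^ k * x) : (θ - 1) ^ l ∣ x := by
  obtain ⟨y, hy⟩ := hx
  refine ⟨y, sub_eq_zero.1 (h.pow_regular k ?_)⟩
  rw [mul_sub, hy]; ring

/-! ### The model of the Quillen category -/

/-- The ambient group `𝔽_p × R / (θ - 1) ^ e` of the model. -/
abbrev ModelSpace (p e : ℕ) {R : Type} [CommRing R] (θ : R) : Type :=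
  ZMod p × (R ⧸ Ideal.span {(θ - 1) ^ e})

/-- An object of the model of the Quillen category: an element `v`, which names the complement
generated by `v τ ^ M`, and a subgroup `W` of the model space which lies in the second factor
or is annihilated by `(θ - 1) ^ M` there. -/
structure QuillenModel (p M e : ℕ) {R : Type} [CommRing R] (θ : R) where
  v : R
  W : AddSubgroup (ModelSpace p e θ)
  admissible : (∀ w ∈ W, w.1 = 0) ∨
    (∀ w ∈ W, Ideal.Quotient.mk (Ideal.span {(θ - 1) ^ e}) ((θ - 1) ^ M) * w.2 = 0)

namespace QuillenModel

variable {p M e : ℕ} {R : Type} [CommRing R] {θ : R}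

/-- The homomorphisms between objects of the model which are induced by conjugation. -/
def IsConj (A B : QuillenModel p M e θ) (f : A.W →+ B.W) : Prop :=
  ∃ l : ℕ, (∀ w, (f w).1.1 = w.1.1) ∧
    (∀ w, w.1.1 = 0 → (f w).1.2 = Ideal.Quotient.mk _ (θ ^ l) * w.1.2) ∧
    ((∃ w ∈ A.W, w.1 ≠ 0) → (θ - 1) ^ M ∣ θ ^ l * A.v - B.v)

theorem IsConj.id (A : QuillenModel p M e θ) : IsConj A A (AddMonoidHom.id A.W) :=
  ⟨0, fun _ => rfl, fun w _ => by simp, fun _ => by simp⟩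

theorem IsConj.comp {A B C : QuillenModel p M e θ} {f : A.W →+ B.W} {g : B.W →+ C.W}
    (hf : IsConj A B f) (hg : IsConj B C g) : IsConj A C (g.comp f) := by
  obtain ⟨l, h1, h2, h3⟩ := hf
  obtain ⟨k, h1', h2', h3'⟩ := hg
  refine ⟨k + l, fun w => (h1' _).trans (h1 _), fun w hw => ?_, fun ⟨w, hw, hw'⟩ => ?_⟩
  · rw [AddMonoidHom.comp_apply, h2' _ ((h1 w).trans hw), h2 w hw, pow_add, map_mul, mul_assoc]
  · have hv := h3 ⟨w, hw, hw'⟩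
    have hv' := h3' ⟨f ⟨w, hw⟩, (f ⟨w, hw⟩).2, by rwa [h1]⟩
    have : θ ^ (k + l) * A.v - C.v = θ ^ k * (θ ^ l * A.v - B.v) + (θ ^ k * B.v - C.v) := by ring
    rw [this]
    exact dvd_add (Dvd.dvd.mul_left hv _) hv'

instance : Category (QuillenModel p M e θ) where
  Hom A B := {f : A.W →+ B.W // IsConj A B f}
  id A := ⟨AddMonoidHom.id A.W, IsConj.id A⟩
  comp f g := ⟨g.1.comp f.1, f.2.comp g.2⟩

end QuillenModel

/-! ### Groups with twisted coordinates -/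

/-- Coordinates on an extension `G` of a group with underlying set `R / (θ - 1) ^ m` and product
`x + y + β(x, y)` by a cyclic group `⟨τ⟩` of order `N` acting as multiplication by `θ`. -/
structure TwistedCoords (p M N e m : ℕ) {R : Type} [CommRing R] (θ : R) (G : Type) [Group G] where
  root : IsRamifiedRoot p M N e θ
  e_le : e ≤ m
  two_M_le : 2 * M ≤ m
  c : R → G
  τ : G
  ρ : G →* Multiplicative (ZMod N)
  β : R →+ R →+ R
  b : ℕ
  e_le_b : e ≤ b
  M_lt_b : M < b
  c_eq : ∀ {x y}, c x = c y ↔ (θ - 1) ^ m ∣ x - y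
  c_mul : ∀ x y, c x * c y = c (x + y + β x y)
  exists_c : ∀ {g}, ρ g = 1 → ∃ x, g = c x
  ρ_c : ∀ x, ρ (c x) = 1
  ρ_τ : ρ τ = .ofAdd 1
  τ_pow : τ ^ N = 1
  τ_c : ∀ x, τ * c x = c (θ * x) * τ
  -- `β_dvd` makes β negligible on elements of order p (as e ≤ b) and a higher-order correction to 1
  -- - ω (as M < b). `β_β` discards iterated terms. `β_omega` keeps the order of v τ ^ M equal to p.
  β_dvd : ∀ s x y, (θ - 1) ^ (s + b) ∣ β ((θ - 1) ^ s * x) y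
  β_β : ∀ x y z, (θ - 1) ^ m ∣ β (β x y) z
  β_omega : ∀ i j x, β ((θ ^ M) ^ i * x) ((θ ^ M) ^ j * x) = 0

/-! ### Calculation rules in twisted coordinates -/

namespace TwistedCoords

variable {p M N e m : ℕ} {R : Type} [CommRing R] {θ : R} {G : Type} [Group G]
  (D : TwistedCoords p M N e m θ G)

theorem β_self (x : R) : D.β x x = 0 := by
  simpa using D.β_omega 0 0 x

theorem β_swap (x y : R) : D.β y x = - D.β x y := by
  have h := D.β_self (x + y)
  simp only [map_add, AddMonoidHom.add_apply, D.β_self] at h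
  linear_combination h

theorem β_self_omega (x : R) : D.β x (θ ^ M * x) = 0 := by
  simpa using D.β_omega 0 1 x

theorem c_zero : D.c 0 = 1 := by
  have h := D.c_mul 0 0
  rw [map_zero, add_zero, add_zero] at h
  exact mul_eq_left.1 h

theorem c_eq_one {x : R} : D.c x = 1 ↔ (θ - 1) ^ m ∣ x := by
  rw [← D.c_zero, D.c_eq, sub_zero]

theorem c_neg (x : R) : D.c (-x) = (D.c x)⁻¹ := by
  refine eq_inv_of_mul_eq_one_left ?_
  rw [D.c_mul, map_neg, AddMonoidHom.neg_apply, D.β_self, neg_zero, add_zero, neg_add_cancel,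
    D.c_zero]

theorem c_pow (x : R) (k : ℕ) : D.c x ^ k = D.c (k * x) := by
  induction k with
  | zero => simp [D.c_zero]
  | succ k ih =>
    rw [pow_succ, ih, D.c_mul, ← nsmul_eq_mul k x, map_nsmul, AddMonoidHom.nsmul_apply, D.β_self,
      smul_zero, add_zero, Nat.cast_succ, add_mul, one_mul, nsmul_eq_mul]

theorem τ_pow_c (l : ℕ) (x : R) : D.τ ^ l * D.c x = D.c (θ ^ l * x) * D.τ ^ l := by
  induction l generalizing x with
  | zero => simp
  | succ l ih => rw [pow_succ, mul_assoc, D.τ_c, ← mul_assoc, ih, mul_assoc, ← pow_succ,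
      ← mul_assoc, ← pow_succ]

theorem eq_c_mul_τ_pow [NeZero N] (g : G) : ∃ (x : R) (l : ℕ),
    (D.ρ g).toAdd = l ∧ g = D.c x * D.τ ^ l := by
  obtain ⟨x, hx⟩ := D.exists_c (g := g * (D.τ ^ (D.ρ g).toAdd.val)⁻¹) (by
    rw [map_mul, map_inv, map_pow, D.ρ_τ, mul_inv_eq_one, ← ofAdd_nsmul, nsmul_one,
      ZMod.natCast_zmod_val, ofAdd_toAdd])
  exact ⟨x, _, (ZMod.natCast_zmod_val _).symm, by rw [← hx, inv_mul_cancel_right]⟩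

/-! #### The elements of order `p` in the kernel of `ρ` -/

/-- The β-term is divisible by (θ - 1) ^ (m - e + b), hence vanishes because e ≤ b. -/
theorem c_mul_of_dvd {x y : R} (hx : (θ - 1) ^ (m - e) ∣ x) : D.c x * D.c y = D.c (x + y) := by
  obtain ⟨x, rfl⟩ := hx
  rw [D.c_mul, D.c_eq, add_sub_cancel_left]
  exact (pow_dvd_pow _ (by have := D.e_le; have := D.e_le_b; omega)).trans (D.β_dvd _ _ _)

theorem c_mul_comm_of_dvd {x y : R} (hx : (θ - 1) ^ (m - e) ∣ x) :
    D.c x * D.c y = D.c y * D.c x := by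
  have h := D.c_mul y x
  rw [D.c_mul_of_dvd hx, h, add_comm, D.c_eq, sub_add_cancel_left, D.β_swap, neg_neg]
  obtain ⟨x, rfl⟩ := hx
  exact (pow_dvd_pow _ (by have := D.e_le; have := D.e_le_b; omega)).trans (D.β_dvd _ _ _)

/-- The embedding of `R / (θ - 1) ^ e` onto the set of elements of order dividing `p` in the
kernel of `ρ`. -/
noncomputable def om (z : R ⧸ Ideal.span {(θ - 1) ^ e}) : G :=
  D.c ((θ - 1) ^ (m - e) * (Ideal.Quotient.mk_surjective z).choose)

theorem c_eq_of_mk {x y : R} :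
    D.c ((θ - 1) ^ (m - e) * x) = D.c ((θ - 1) ^ (m - e) * y) ↔
      Ideal.Quotient.mk (Ideal.span {(θ - 1) ^ e}) x = Ideal.Quotient.mk _ y := by
  have hm : m = (m - e) + e := by have := D.e_le; omega
  rw [D.c_eq, Ideal.Quotient.eq, Ideal.mem_span_singleton, ← mul_sub]
  constructor
  · intro h
    rw [hm, Nat.add_sub_cancel] at h
    exact D.root.pow_dvd_cancel _ _ h
  · intro h
    conv_lhs => rw [hm, pow_add]
    exact mul_dvd_mul_left _ h

theorem om_mk (x : R) : D.om (Ideal.Quotient.mk _ x) = D.c ((θ - 1) ^ (m - e) * x) :=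
  D.c_eq_of_mk.2 (Ideal.Quotient.mk_surjective (Ideal.Quotient.mk _ x)).choose_spec

theorem om_injective : Function.Injective D.om := by
  intro z z' h
  obtain ⟨x, rfl⟩ := Ideal.Quotient.mk_surjective z
  obtain ⟨y, rfl⟩ := Ideal.Quotient.mk_surjective z'
  rwa [om_mk, om_mk, c_eq_of_mk] at h

theorem om_add (z z' : R ⧸ Ideal.span {(θ - 1) ^ e}) : D.om (z + z') = D.om z * D.om z' := by
  obtain ⟨x, rfl⟩ := Ideal.Quotient.mk_surjective z
  obtain ⟨y, rfl⟩ := Ideal.Quotient.mk_surjective z'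
  rw [← map_add, om_mk, om_mk, om_mk, D.c_mul_of_dvd ⟨_, rfl⟩, mul_add]

theorem om_zero : D.om 0 = 1 := by
  rw [← map_zero (Ideal.Quotient.mk _), om_mk, mul_zero, D.c_zero]

theorem ρ_om (z : R ⧸ Ideal.span {(θ - 1) ^ e}) : D.ρ (D.om z) = 1 := D.ρ_c _

theorem om_commute_c (z : R ⧸ Ideal.span {(θ - 1) ^ e}) (x : R) :
    D.om z * D.c x = D.c x * D.om z :=
  D.c_mul_comm_of_dvd ⟨_, rfl⟩

theorem τ_pow_om (l : ℕ) (z : R ⧸ Ideal.span {(θ - 1) ^ e}) :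
    D.τ ^ l * D.om z = D.om (Ideal.Quotient.mk _ (θ ^ l) * z) * D.τ ^ l := by
  obtain ⟨x, rfl⟩ := Ideal.Quotient.mk_surjective z
  rw [← map_mul, om_mk, om_mk, D.τ_pow_c, mul_left_comm]

theorem om_pow (z : R ⧸ Ideal.span {(θ - 1) ^ e}) : D.om z ^ p = 1 := by
  obtain ⟨x, rfl⟩ := Ideal.Quotient.mk_surjective z
  rw [om_mk, D.c_pow, D.c_eq_one]
  have hm : m = e + (m - e) := by have := D.e_le; omega
  conv_lhs => rw [hm, pow_add]
  exact mul_dvd_mul D.root.dvd_prime (dvd_mul_right _ _)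

/-- A p-th power multiplies the coordinate by p, which is (θ - 1) ^ e up to mutual divisibility;
cancelling leaves divisibility by (θ - 1) ^ (m - e). -/
theorem exists_om {g : G} (hρ : D.ρ g = 1) (hg : g ^ p = 1) : ∃ z, g = D.om z := by
  obtain ⟨x, rfl⟩ := D.exists_c hρ
  rw [D.c_pow, D.c_eq_one] at hg
  have hm : m = e + (m - e) := by have := D.e_le; omega
  obtain ⟨r, hr⟩ := D.root.prime_dvd
  have h : (θ - 1) ^ (m - e) ∣ x := by
    refine D.root.pow_dvd_cancel e _ ?_
    rw [← hm, hr]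
    exact hg.trans ⟨r, by ring⟩
  obtain ⟨y, rfl⟩ := h
  exact ⟨_, (D.om_mk y).symm⟩

/-! #### The elements of order `p` outside the kernel of `ρ` -/

/-- The element `v τ ^ M`, of order `p`. -/
def s (v : R) : G := D.c v * D.τ ^ M

/-- Moving powers of τ ^ M to the right collects the terms (θ ^ M) ^ i * v, and all β cross terms
between these vanish. -/
theorem s_pow_eq (v : R) (k : ℕ) :
    D.s v ^ k = D.c ((∑ i ∈ Finset.range k, (θ ^ M) ^ i) * v) * D.τ ^ (M * k) := by
  induction k with
  | zero => simp [D.c_zero]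
  | succ k ih =>
    rw [pow_succ, ih, s, mul_assoc, ← mul_assoc (D.τ ^ (M * k)), D.τ_pow_c, mul_assoc,
      ← mul_assoc, D.c_mul, ← pow_add, Finset.sum_range_succ, pow_mul θ]
    have : D.β ((∑ i ∈ Finset.range k, (θ ^ M) ^ i) * v) ((θ ^ M) ^ k * v) = 0 := by
      rw [Finset.sum_mul, map_sum, AddMonoidHom.finsetSum_apply]
      exact Finset.sum_eq_zero fun i _ => D.β_omega i k v
    rw [this, add_zero, add_mul]
    rfl

theorem s_pow (v : R) : D.s v ^ p = 1 := by
  rw [s_pow_eq, D.root.geom_sum, zero_mul, D.c_zero, one_mul, mul_comm M, ← D.root.N_eq, D.τ_pow]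

theorem ρ_s (v : R) : D.ρ (D.s v) = .ofAdd (M : ZMod N) := by
  rw [s, map_mul, map_pow, D.ρ_c, D.ρ_τ, one_mul, ← ofAdd_nsmul, nsmul_one]

theorem s_eq {v v' : R} : D.s v = D.s v' ↔ (θ - 1) ^ m ∣ v - v' := by
  rw [s, s, mul_left_inj, D.c_eq]

theorem om_mk_mul_s (x v : R) :
    D.om (Ideal.Quotient.mk _ x) * D.s v = D.s ((θ - 1) ^ (m - e) * x + v) := by
  rw [om_mk, s, ← mul_assoc, D.c_mul_of_dvd ⟨_, rfl⟩, s]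

/-- Since `c v` centralizes the image of `om`, only τ ^ M matters. It acts as θ ^ M, and θ ^ M - 1
is associated to (θ - 1) ^ M. -/
theorem om_commute_s_iff (z : R ⧸ Ideal.span {(θ - 1) ^ e}) (v : R) :
    Commute (D.om z) (D.s v) ↔ Ideal.Quotient.mk _ ((θ - 1) ^ M) * z = 0 := by
  have h : Commute (D.om z) (D.s v) ↔ Ideal.Quotient.mk _ (θ ^ M) * z = z := by
    rw [Commute, SemiconjBy, s, mul_assoc (D.c v), D.τ_pow_om, ← mul_assoc, D.om_commute_c,
      mul_assoc, mul_right_inj, mul_left_inj, D.om_injective.eq_iff, eq_comm]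
  rw [h]
  obtain ⟨x, rfl⟩ := Ideal.Quotient.mk_surjective z
  rw [← map_mul, ← map_mul, Ideal.Quotient.eq, Ideal.Quotient.eq_zero_iff_mem,
    Ideal.mem_span_singleton, Ideal.mem_span_singleton,
    show θ ^ M * x - x = (θ ^ M - 1) * x by ring]
  exact ⟨fun h => h.trans (mul_dvd_mul_right D.root.omega_dvd _),
    fun h => h.trans (mul_dvd_mul_right D.root.dvd_omega _)⟩

/-! ### Conjugation of the complements by the kernel -/

/-- The displacement of `v` when `v τ ^ M` is conjugated by `x`. -/
def disp (v x : R) : R := (1 - θ ^ M) * x + D.β (x + θ ^ M * x) v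

theorem disp_add (v x y : R) : D.disp v (x + y) = D.disp v x + D.disp v y := by
  simp only [disp, mul_add, map_add, AddMonoidHom.add_apply]; ring

theorem c_conj_s (x v : R) : D.c x * D.s v * (D.c x)⁻¹ = D.s (v + D.disp v x) := by
  rw [s, ← D.c_neg, mul_assoc, mul_assoc, D.τ_pow_c, ← mul_assoc, ← mul_assoc, s, D.c_mul, D.c_mul,
    mul_left_inj, D.c_eq]
  have h : x + v + D.β x v + θ ^ M * -x + D.β (x + v + D.β x v) (θ ^ M * -x) - (v + D.disp v x)
      = - D.β (D.β x v) (θ ^ M * x) := by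
    simp only [disp, map_add, AddMonoidHom.add_apply, mul_neg, map_neg, D.β_self_omega,
      D.β_swap (θ ^ M * x) v]
    ring
  rw [h]
  exact (D.β_β _ _ _).neg_right

theorem dvd_disp (v x : R) : (θ - 1) ^ M ∣ D.disp v x := by
  refine dvd_add (Dvd.dvd.mul_right ?_ _) ?_
  · rw [← neg_sub (θ ^ M)]; exact D.root.dvd_omega.neg_right
  · have h := D.β_dvd 0 (x + θ ^ M * x) v
    rw [pow_zero, one_mul, zero_add] at h
    exact (pow_dvd_pow _ D.M_lt_b.le).trans h

/-- Successive approximation: the leading part 1 - θ ^ M of the displacement can be inverted on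
multiples of (θ - 1) ^ M, and the β-part only contributes to higher order. -/
theorem exists_disp {v t : R} (ht : (θ - 1) ^ M ∣ t) : ∃ x, (θ - 1) ^ m ∣ t - D.disp v x := by
  suffices h : ∀ k, ∃ x, (θ - 1) ^ (M + k) ∣ t - D.disp v x by
    obtain ⟨x, hx⟩ := h m
    exact ⟨x, (pow_dvd_pow _ (by omega)).trans hx⟩
  intro k
  induction k with
  | zero => exact ⟨0, by simpa [disp] using ht⟩
  | succ k ih =>
    obtain ⟨x, y, hy⟩ := ih
    obtain ⟨r, hr⟩ := D.root.omega_dvd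
    -- As (θ - 1) ^ M = (θ ^ M - 1) * r, the linear part of this correction cancels the error (θ -
    -- 1) ^ (M + k) * y. The remaining β-term is divisible by (θ - 1) ^ (k + b), and b ≥ M + 1.
    refine ⟨x + (θ - 1) ^ k * (-r * y), ?_⟩
    have h1 := D.β_dvd k (-r * y + θ ^ M * (-r * y)) v
    have h2 : t - D.disp v (x + (θ - 1) ^ k * (-r * y)) =
        - D.β ((θ - 1) ^ k * (-r * y + θ ^ M * (-r * y))) v := by
      rw [disp_add, ← sub_sub, hy, disp, pow_add, hr, mul_add, mul_left_comm (θ ^ M)]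
      ring
    rw [h2]
    exact ((pow_dvd_pow _ (by have := D.M_lt_b; omega)).trans h1).neg_right

/-! #### Points of the model space -/

/-- The element of `G` with coordinates `w` in the chart of `v`. -/
noncomputable def pt (v : R) (w : ModelSpace p e θ) : G := D.om w.2 * D.s v ^ w.1.val

theorem pt_of_fst_eq_zero [NeZero p] (v : R) {w : ModelSpace p e θ} (h : w.1 = 0) :
    D.pt v w = D.om w.2 := by
  rw [pt, h, ZMod.val_zero, pow_zero, mul_one]

theorem pt_of_fst_eq_one [Fact p.Prime] (v : R) {w : ModelSpace p e θ} (h : w.1 = 1) :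
    D.pt v w = D.om w.2 * D.s v := by
  rw [pt, h, ZMod.val_one, pow_one]

theorem ρ_pt (v : R) (w : ModelSpace p e θ) :
    D.ρ (D.pt v w) = .ofAdd ((M * w.1.val : ℕ) : ZMod N) := by
  rw [pt, map_mul, map_pow, D.ρ_om, D.ρ_s, one_mul, ← ofAdd_nsmul, nsmul_eq_mul, mul_comm,
    Nat.cast_mul]

theorem fst_eq_of_ρ_pt [NeZero p] {v v' : R} {w w' : ModelSpace p e θ}
    (h : D.ρ (D.pt v w) = D.ρ (D.pt v' w')) : w.1 = w'.1 := by
  rw [ρ_pt, ρ_pt] at h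
  have h1 := (ZMod.natCast_eq_natCast_iff' _ _ _).1 (Multiplicative.ofAdd.injective h)
  -- The multiples M * k with k < p stay below N = p * M, so the image in `ZMod N` determines k
  -- without wrapping around.
  have hlt : ∀ k : ZMod p, M * k.val < N := fun k => by
    rw [D.root.N_eq, mul_comm]; exact Nat.mul_lt_mul_of_pos_right (ZMod.val_lt k) D.root.M_pos
  rw [Nat.mod_eq_of_lt (hlt _), Nat.mod_eq_of_lt (hlt _)] at h1
  exact ZMod.val_injective _ (Nat.eq_of_mul_eq_mul_left D.root.M_pos h1)

theorem pt_injective [NeZero p] (v : R) : Function.Injective (D.pt v) := by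
  intro w w' h
  have h1 := D.fst_eq_of_ρ_pt (congrArg D.ρ h)
  refine Prod.ext h1 (D.om_injective ?_)
  rw [pt, pt, h1] at h
  exact mul_right_cancel h

theorem s_pow_val_add [NeZero p] (v : R) (k l : ZMod p) :
    D.s v ^ (k + l).val = D.s v ^ k.val * D.s v ^ l.val := by
  rw [← pow_add, ZMod.val_add]
  exact (pow_eq_pow_mod _ (D.s_pow v)).symm

/-- The chart is additive as soon as `om w'.2` commutes with the power of `s v` in front of it; the
two alternatives match those of `QuillenModel.admissible`. -/
theorem pt_add [NeZero p] (v : R) {w w' : ModelSpace p e θ}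
    (h : w.1 = 0 ∨ Ideal.Quotient.mk _ ((θ - 1) ^ M) * w'.2 = 0) :
    D.pt v (w + w') = D.pt v w * D.pt v w' := by
  have hc : Commute (D.om w'.2) (D.s v ^ w.1.val) := by
    rcases h with h | h
    · rw [h, ZMod.val_zero, pow_zero]; exact Commute.one_right _
    · exact ((D.om_commute_s_iff _ _).2 h).pow_right _
  rw [pt, pt, pt, Prod.snd_add, Prod.fst_add, D.om_add, s_pow_val_add, mul_assoc, mul_assoc,
    ← mul_assoc (D.om w'.2), hc.eq, mul_assoc]

theorem pt_zero [NeZero p] (v : R) : D.pt v 0 = 1 := by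
  rw [pt_of_fst_eq_zero _ _ rfl]; exact D.om_zero

end TwistedCoords

theorem natCast_mul_eq_natCast_mul {p M N k k' : ℕ} (hN : N = p * M) (h : (k : ZMod p) = k') :
    ((M * k : ℕ) : ZMod N) = ((M * k' : ℕ) : ZMod N) := by
  rw [ZMod.natCast_eq_natCast_iff, hN, mul_comm p]
  exact ((ZMod.natCast_eq_natCast_iff _ _ _).1 h).mul_left' M

namespace TwistedCoords

variable {p M N e m : ℕ} {R : Type} [CommRing R] {θ : R} {G : Type} [Group G]
  (D : TwistedCoords p M N e m θ G)

/-! ### Conjugation in the group and in the model -/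

theorem conj_om (x : R) (l : ℕ) (z : R ⧸ Ideal.span {(θ - 1) ^ e}) :
    D.c x * D.τ ^ l * D.om z * (D.c x * D.τ ^ l)⁻¹ = D.om (Ideal.Quotient.mk _ (θ ^ l) * z) := by
  rw [mul_inv_eq_iff_eq_mul, mul_assoc, D.τ_pow_om, ← mul_assoc, ← mul_assoc, D.om_commute_c]

theorem conj_s (x v : R) (l : ℕ) :
    D.c x * D.τ ^ l * D.s v * (D.c x * D.τ ^ l)⁻¹ =
      D.s (θ ^ l * v + D.disp (θ ^ l * v) x) := by
  rw [← D.c_conj_s, mul_inv_eq_iff_eq_mul, s, s, mul_assoc (D.c x), ← mul_assoc (D.τ ^ l),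
    D.τ_pow_c]
  simp only [mul_assoc, inv_mul_cancel_left]
  rw [← pow_add, ← pow_add, add_comm]

/-- The annihilator of (θ - 1) ^ M modulo (θ - 1) ^ e is generated by (θ - 1) ^ (e - M), and (m - e)
+ (e - M) = m - M ≥ M. Elements commuting with a complement are therefore invisible modulo (θ - 1) ^
M. -/
theorem pow_dvd_of_mul_mk_eq_zero (D : TwistedCoords p M N e m θ G) {x : R}
    (hx : Ideal.Quotient.mk (Ideal.span {(θ - 1) ^ e}) ((θ - 1) ^ M) *
      Ideal.Quotient.mk _ x = 0) : (θ - 1) ^ M ∣ (θ - 1) ^ (m - e) * x := by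
  have he := D.e_le
  have hM := D.root.M_le_e
  have h2 := D.two_M_le
  rw [← map_mul, Ideal.Quotient.eq_zero_iff_mem, Ideal.mem_span_singleton] at hx
  have h : (θ - 1) ^ (e - M) ∣ x :=
    D.root.pow_dvd_cancel M _ (by rwa [Nat.add_sub_cancel' hM])
  refine (pow_dvd_pow _ (show M ≤ (m - e) + (e - M) by omega)).trans ?_
  rw [pow_add]
  exact mul_dvd_mul_left _ h

variable [Fact p.Prime]

/-- The embedding of an object of the model into `G`. -/
noncomputable def emb (A : QuillenModel p M e θ) : Multiplicative A.W →* G where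
  toFun w := D.pt A.v w.toAdd
  map_one' := D.pt_zero A.v
  map_mul' w w' := D.pt_add A.v (A.admissible.imp (fun h => h _ w.toAdd.2) (fun h => h _ w'.toAdd.2))

theorem emb_injective (A : QuillenModel p M e θ) : Function.Injective (D.emb A) :=
  fun _ _ h => Subtype.ext (D.pt_injective A.v h)

theorem emb_comm {A : QuillenModel p M e θ} (w w' : Multiplicative A.W) :
    D.emb A w * D.emb A w' = D.emb A w' * D.emb A w := by
  rw [← map_mul, mul_comm, map_mul]

theorem emb_pow {A : QuillenModel p M e θ} (w : Multiplicative A.W) : D.emb A w ^ p = 1 := by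
  have h : ∀ w : A.W, p • w = 0 := by
    intro w
    refine Subtype.ext (Prod.ext ?_ (D.om_injective ?_))
    · change p • w.1.1 = 0
      rw [nsmul_eq_mul, CharP.cast_eq_zero, zero_mul]
    · change D.om (p • w.1.2) = D.om 0
      obtain ⟨x, hx⟩ := Ideal.Quotient.mk_surjective w.1.2
      rw [← hx, ← map_nsmul, nsmul_eq_mul, D.om_zero, om_mk, mul_left_comm, ← D.c_pow, ← om_mk,
        D.om_pow]
  rw [← map_pow, ← ofAdd_toAdd w, ← ofAdd_nsmul, h, ofAdd_zero, map_one]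

theorem exists_fst_eq_one {A : QuillenModel p M e θ} (h : ∃ w ∈ A.W, w.1 ≠ 0) :
    ∃ w : A.W, w.1.1 = 1 := by
  obtain ⟨w, hw, h0⟩ := h
  refine ⟨(w.1⁻¹).val • ⟨w, hw⟩, ?_⟩
  change (w.1⁻¹).val • w.1 = 1
  rw [nsmul_eq_mul, ZMod.natCast_zmod_val, inv_mul_cancel₀ h0]

theorem mul_snd_eq_zero {A : QuillenModel p M e θ} {w : A.W} (hw : w.1.1 = 1) (w' : A.W) :
    Ideal.Quotient.mk _ ((θ - 1) ^ M) * w'.1.2 = 0 := by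
  refine (A.admissible.resolve_left fun h => ?_) _ w'.2
  exact one_ne_zero (hw.symm.trans (h _ w.2))

/-- Writing g = c x * τ ^ l gives the exponent l. The factor `c x` fixes the `om` part and moves v
only by a multiple of (θ - 1) ^ M, so x leaves no trace in the conditions. -/
theorem isConj_of_conj [NeZero N] {A B : QuillenModel p M e θ} {f : A.W →+ B.W} {g : G}
    (h : ∀ w, D.pt B.v (f w) = g * D.pt A.v w * g⁻¹) : A.IsConj B f := by
  have h1 : ∀ w, (f w).1.1 = w.1.1 := fun w => D.fst_eq_of_ρ_pt (v := B.v) (v' := A.v) (by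
    rw [h, map_mul, map_mul, mul_comm, map_inv, inv_mul_cancel_left])
  obtain ⟨x, l, -, rfl⟩ := D.eq_c_mul_τ_pow g
  refine ⟨l, h1, fun w hw => ?_, fun hA => ?_⟩
  · have hw' := h w
    rw [D.pt_of_fst_eq_zero _ hw, D.pt_of_fst_eq_zero _ ((h1 w).trans hw), conj_om] at hw'
    exact D.om_injective hw'
  · obtain ⟨w, hw⟩ := exists_fst_eq_one hA
    have hw' := h w
    have hz := mul_snd_eq_zero hw w
    have hz' := mul_snd_eq_zero ((h1 w).trans hw) (f w)
    rw [D.pt_of_fst_eq_one _ hw, D.pt_of_fst_eq_one _ ((h1 w).trans hw), ← conj_mul, conj_om,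
      conj_s] at hw'
    obtain ⟨y, hy⟩ := Ideal.Quotient.mk_surjective w.1.2
    obtain ⟨y', hy'⟩ := Ideal.Quotient.mk_surjective (f w).1.2
    rw [← hy] at hz hw'
    rw [← hy'] at hz' hw'
    rw [← map_mul, om_mk_mul_s, om_mk_mul_s, s_eq] at hw'
    have hd := (pow_dvd_pow (θ - 1) (by have := D.two_M_le; omega : M ≤ m)).trans hw'
    have h3 := D.pow_dvd_of_mul_mk_eq_zero hz
    have h4 := D.pow_dvd_of_mul_mk_eq_zero hz'
    have h5 := D.dvd_disp (θ ^ l * A.v) x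
    have : θ ^ l * A.v - B.v = (θ - 1) ^ (m - e) * y' - θ ^ l * ((θ - 1) ^ (m - e) * y) -
      D.disp (θ ^ l * A.v) x - ((θ - 1) ^ (m - e) * y' + B.v -
        ((θ - 1) ^ (m - e) * (θ ^ l * y) + (θ ^ l * A.v + D.disp (θ ^ l * A.v) x))) := by ring
    rw [this]
    exact dvd_sub (dvd_sub (dvd_sub h4 (h3.mul_left _)) h5) hd

/-- On vectors with first coordinate 0 every c x * τ ^ l with the given l works, so x is free to be
chosen to match f on a single vector with first coordinate 1; additivity does the rest. -/
theorem exists_conj {A B : QuillenModel p M e θ} {f : A.W →+ B.W} (hf : A.IsConj B f) :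
    ∃ g : G, ∀ w, D.pt B.v (f w) = g * D.pt A.v w * g⁻¹ := by
  obtain ⟨l, h1, h2, h3⟩ := hf
  have h0 : ∀ (x : R) (w : A.W), w.1.1 = 0 → D.pt B.v (f w) =
      D.c x * D.τ ^ l * D.pt A.v w * (D.c x * D.τ ^ l)⁻¹ := fun x w hw => by
    rw [D.pt_of_fst_eq_zero _ hw, D.pt_of_fst_eq_zero _ ((h1 w).trans hw), conj_om, h2 w hw]
  by_cases hA : ∃ w ∈ A.W, w.1 ≠ 0
  · obtain ⟨w, hw⟩ := exists_fst_eq_one hA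
    have hz := mul_snd_eq_zero hw w
    have hz' := mul_snd_eq_zero ((h1 w).trans hw) (f w)
    obtain ⟨y, hy⟩ := Ideal.Quotient.mk_surjective w.1.2
    obtain ⟨y', hy'⟩ := Ideal.Quotient.mk_surjective (f w).1.2
    rw [← hy] at hz
    rw [← hy'] at hz'
    -- This is the displacement that x must produce.
    have ht : (θ - 1) ^ M ∣ (θ - 1) ^ (m - e) * y' + B.v -
        ((θ - 1) ^ (m - e) * (θ ^ l * y) + θ ^ l * A.v) := by
      have h4 := D.pow_dvd_of_mul_mk_eq_zero hz
      have h5 := D.pow_dvd_of_mul_mk_eq_zero hz'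
      have : (θ - 1) ^ (m - e) * y' + B.v - ((θ - 1) ^ (m - e) * (θ ^ l * y) + θ ^ l * A.v) =
        (θ - 1) ^ (m - e) * y' - θ ^ l * ((θ - 1) ^ (m - e) * y) - (θ ^ l * A.v - B.v) := by ring
      rw [this]
      exact dvd_sub (dvd_sub h5 (h4.mul_left _)) (h3 hA)
    obtain ⟨x, hx⟩ := D.exists_disp (v := θ ^ l * A.v) ht
    refine ⟨D.c x * D.τ ^ l, fun w' => ?_⟩
    have hone : D.pt B.v (f w) = D.c x * D.τ ^ l * D.pt A.v w * (D.c x * D.τ ^ l)⁻¹ := by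
      rw [D.pt_of_fst_eq_one _ hw, D.pt_of_fst_eq_one _ ((h1 w).trans hw), ← conj_mul, conj_om,
        conj_s, ← hy, ← hy', ← map_mul, om_mk_mul_s, om_mk_mul_s, s_eq]
      rwa [← add_assoc, ← sub_sub]
    -- Split off a multiple of w, so that the remainder has first coordinate 0.
    have hdec : w' = w'.1.1.val • w + (w' - w'.1.1.val • w) := by abel
    have hzero : (w' - w'.1.1.val • w).1.1 = 0 := by
      change w'.1.1 - w'.1.1.val • w.1.1 = 0
      rw [hw, nsmul_one, ZMod.natCast_zmod_val, sub_self]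
    have key : (D.emb B).comp f.toMultiplicative (.ofAdd w') =
        ((MulAut.conj (D.c x * D.τ ^ l)).toMonoidHom.comp (D.emb A)) (.ofAdd w') := by
      rw [hdec, ofAdd_add, ofAdd_nsmul, map_mul, map_mul, map_pow, map_pow]
      congr 1
      · exact congrArg (· ^ _) hone
      · exact h0 x _ hzero
    exact key
  · refine ⟨D.c 0 * D.τ ^ l, fun w => h0 0 w ?_⟩
    by_contra hw
    exact hA ⟨w, w.2, hw⟩

/-! ### The equivalence of the model with the Quillen category -/

/-- The elementary abelian subgroup of `G` given by an object of the model. -/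
noncomputable def obj (A : QuillenModel p M e θ) : QuillenCat p G where
  carrier := (D.emb A).range
  comm := by
    rintro _ ⟨w, rfl⟩ _ ⟨w', rfl⟩
    exact D.emb_comm w w'
  pow_eq_one := by
    rintro _ ⟨w, rfl⟩
    exact D.emb_pow w

/-- The isomorphism of an object of the model with its image in `G`. -/
noncomputable def embEquiv (A : QuillenModel p M e θ) : Multiplicative A.W ≃* (D.obj A).carrier :=
  MonoidHom.ofInjective (D.emb_injective A)

theorem coe_embEquiv {A : QuillenModel p M e θ} (w : Multiplicative A.W) :
    (D.embEquiv A w : G) = D.pt A.v w.toAdd := rfl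

/-- The functor from the model to the Quillen category of `G`. -/
noncomputable def functor : QuillenModel p M e θ ⥤ QuillenCat p G where
  obj := D.obj
  map {A B} f := ⟨((D.embEquiv B).toMonoidHom.comp f.1.toMultiplicative).comp
      (D.embEquiv A).symm.toMonoidHom, by
    obtain ⟨g, hg⟩ := D.exists_conj f.2
    refine ⟨g, fun x => ?_⟩
    obtain ⟨w, rfl⟩ := (D.embEquiv A).surjective x
    simpa [coe_embEquiv] using hg w.toAdd⟩
  map_id A := Subtype.ext (MonoidHom.ext fun x => (D.embEquiv A).apply_symm_apply x)
  map_comp {A B C} f g := Subtype.ext (MonoidHom.ext fun x => by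
    change D.embEquiv C _ = D.embEquiv C (g.1.toMultiplicative ((D.embEquiv B).symm
      (D.embEquiv B (f.1.toMultiplicative ((D.embEquiv A).symm x)))))
    rw [MulEquiv.symm_apply_apply]
    rfl)

theorem functor_map_apply {A B : QuillenModel p M e θ} (f : A ⟶ B) (w : A.W) :
    (D.functor.map f).1 (D.embEquiv A (.ofAdd w)) = D.embEquiv B (.ofAdd (f.1 w)) := by
  change D.embEquiv B (f.1.toMultiplicative ((D.embEquiv A).symm (D.embEquiv A (.ofAdd w)))) = _
  rw [MulEquiv.symm_apply_apply]
  rfl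

instance : D.functor.Faithful where
  map_injective {A B} f g h := by
    refine Subtype.ext (AddMonoidHom.ext fun w => ?_)
    have h' := (D.functor_map_apply f w).symm.trans
      ((congrArg (fun k => k.1 (D.embEquiv A (.ofAdd w))) h).trans (D.functor_map_apply g w))
    exact Multiplicative.ofAdd.injective ((D.embEquiv B).injective h')

theorem functor_full [NeZero N] : D.functor.Full where
  map_surjective {A B} f := by
    obtain ⟨f, g, hg⟩ := f
    let f' : A.W →+ B.W := MonoidHom.toAdditive
      (((D.embEquiv B).symm.toMonoidHom.comp f).comp (D.embEquiv A).toMonoidHom)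
    have hf' : ∀ w, D.embEquiv B (.ofAdd (f' w)) = f (D.embEquiv A (.ofAdd w)) := fun w =>
      (D.embEquiv B).apply_symm_apply _
    refine ⟨⟨f', D.isConj_of_conj (g := g) fun w => ?_⟩, ?_⟩
    · exact (congrArg Subtype.val (hf' w)).trans (hg _)
    · refine Subtype.ext (MonoidHom.ext fun x => ?_)
      obtain ⟨w, rfl⟩ := (D.embEquiv A).surjective x
      exact (D.functor_map_apply _ w.toAdd).trans (hf' w.toAdd)

/-! ### Essential surjectivity -/

/-- The object of the model given by a subgroup of `G` contained in the image of an admissible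
subgroup of the model space. -/
def preimage (v : R) (E : Subgroup G) (A : AddSubgroup (ModelSpace p e θ))
    (hA : (∀ w ∈ A, w.1 = 0) ∨
      (∀ w ∈ A, Ideal.Quotient.mk (Ideal.span {(θ - 1) ^ e}) ((θ - 1) ^ M) * w.2 = 0)) :
    QuillenModel p M e θ where
  v := v
  W := {
    carrier := {w | w ∈ A ∧ D.pt v w ∈ E}
    zero_mem' := ⟨A.zero_mem, by rw [D.pt_zero]; exact E.one_mem⟩
    add_mem' := fun {w w'} h h' => ⟨A.add_mem h.1 h'.1, by
      rw [D.pt_add v (hA.imp (fun H => H _ h.1) (fun H => H _ h'.1))]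
      exact E.mul_mem h.2 h'.2⟩
    neg_mem' := fun {w} h => ⟨A.neg_mem h.1, by
      have h0 : D.pt v w * D.pt v (-w) = 1 := by
        rw [← D.pt_add v (hA.imp (fun H => H _ h.1) (fun H => H _ (A.neg_mem h.1))), add_neg_cancel,
          D.pt_zero]
      rw [eq_inv_of_mul_eq_one_right h0]
      exact E.inv_mem h.2⟩ }
  admissible := hA.imp (fun H w hw => H w hw.1) (fun H w hw => H w hw.1)

theorem obj_preimage {v : R} {E : QuillenCat p G} {A : AddSubgroup (ModelSpace p e θ)} (hA)
    (h : ∀ g ∈ E.carrier, ∃ w ∈ A, g = D.pt v w) : D.obj (D.preimage v E.carrier A hA) = E := by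
  have : (D.obj (D.preimage v E.carrier A hA)).carrier = E.carrier := by
    ext g
    constructor
    · rintro ⟨w, rfl⟩
      exact w.toAdd.2.2
    · intro hg
      obtain ⟨w, hw, rfl⟩ := h g hg
      exact ⟨.ofAdd ⟨w, hw, hg⟩, rfl⟩
  cases E
  cases h' : D.obj _
  simp_all

theorem exists_ρ_eq [NeZero N] {g : G} (hg : g ^ p = 1) :
    ∃ k : ℕ, D.ρ g = .ofAdd ((M * k : ℕ) : ZMod N) := by
  obtain ⟨x, l, hl, -⟩ := D.eq_c_mul_τ_pow g
  have h : ((p * l : ℕ) : ZMod N) = 0 := by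
    have h' := congrArg Multiplicative.toAdd ((map_pow D.ρ g p).symm.trans (congrArg D.ρ hg))
    rwa [toAdd_pow, hl, map_one, toAdd_one, nsmul_eq_mul, ← Nat.cast_mul] at h'
  rw [ZMod.natCast_eq_zero_iff, D.root.N_eq] at h
  obtain ⟨k, rfl⟩ := Nat.dvd_of_mul_dvd_mul_left (Fact.out : p.Prime).pos h
  exact ⟨k, by rw [← hl, ofAdd_toAdd]⟩

theorem exists_s_mem [NeZero N] {E : QuillenCat p G} (h : ∃ g ∈ E.carrier, D.ρ g ≠ 1) :
    ∃ v, D.s v ∈ E.carrier := by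
  obtain ⟨g, hg, hρ⟩ := h
  obtain ⟨k, hk⟩ := D.exists_ρ_eq (E.pow_eq_one g hg)
  have hk0 : (k : ZMod p) ≠ 0 := fun h0 => hρ (by
    rw [hk, natCast_mul_eq_natCast_mul D.root.N_eq (k' := 0) (by rw [h0, Nat.cast_zero]), mul_zero, Nat.cast_zero,
      ofAdd_zero])
  -- Raising g to the inverse of k modulo p normalizes its image to that of τ ^ M.
  have hρ' : D.ρ (g ^ ((k : ZMod p)⁻¹).val) = .ofAdd (M : ZMod N) := by
    rw [map_pow, hk, ← ofAdd_nsmul, nsmul_eq_mul, ← Nat.cast_mul, mul_left_comm,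
      natCast_mul_eq_natCast_mul D.root.N_eq (k' := 1), mul_one]
    rw [Nat.cast_mul, ZMod.natCast_zmod_val, inv_mul_cancel₀ hk0, Nat.cast_one]
  obtain ⟨v, hv⟩ := D.exists_c (g := g ^ ((k : ZMod p)⁻¹).val * (D.τ ^ M)⁻¹) (by
    rw [map_mul, map_inv, hρ', map_pow, D.ρ_τ, ← ofAdd_nsmul, nsmul_one, mul_inv_cancel])
  refine ⟨v, ?_⟩
  rw [s, ← hv, inv_mul_cancel_right]
  exact E.carrier.pow_mem hg _

theorem exists_pt_of_mem [NeZero N] {E : QuillenCat p G} {v : R} (hv : D.s v ∈ E.carrier) {g : G}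
    (hg : g ∈ E.carrier) : ∃ w : ModelSpace p e θ,
      Ideal.Quotient.mk _ ((θ - 1) ^ M) * w.2 = 0 ∧ g = D.pt v w := by
  obtain ⟨k, hk⟩ := D.exists_ρ_eq (E.pow_eq_one g hg)
  have hmem : g * (D.s v ^ k)⁻¹ ∈ E.carrier :=
    E.carrier.mul_mem hg (E.carrier.inv_mem (E.carrier.pow_mem hv k))
  obtain ⟨z, hz⟩ := D.exists_om (by
    rw [map_mul, map_inv, map_pow, D.ρ_s, hk, ← ofAdd_nsmul, nsmul_eq_mul, mul_comm,
      Nat.cast_mul, mul_comm (k : ZMod N), inv_mul_cancel]) (E.pow_eq_one _ hmem)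
  refine ⟨(k, z), (D.om_commute_s_iff z v).1 ?_, ?_⟩
  · rw [← hz]
    exact E.comm _ hmem _ hv
  · rw [pt, ← hz, ZMod.val_natCast, ← pow_eq_pow_mod _ (D.s_pow v), inv_mul_cancel_right]

/-- Every E is an image on the nose. If E leaves the kernel of ρ, use the chart of some `s v` in E,
where E commutes with `s v`; otherwise any v serves, and 0 is taken. -/
theorem functor_essSurj [NeZero N] : D.functor.EssSurj where
  mem_essImage E := by
    suffices h : ∃ A, D.obj A = E by
      obtain ⟨A, rfl⟩ := h
      exact ⟨A, ⟨Iso.refl _⟩⟩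
    by_cases h : ∃ g ∈ E.carrier, D.ρ g ≠ 1
    · obtain ⟨v, hv⟩ := D.exists_s_mem h
      let A : AddSubgroup (ModelSpace p e θ) := AddSubgroup.comap (AddMonoidHom.snd _ _)
        (AddMonoidHom.mulLeft (Ideal.Quotient.mk (Ideal.span {(θ - 1) ^ e}) ((θ - 1) ^ M))).ker
      refine ⟨_, D.obj_preimage (v := v) (A := A) (Or.inr fun w hw => hw) fun g hg => ?_⟩
      exact D.exists_pt_of_mem hv hg
    · let A : AddSubgroup (ModelSpace p e θ) := (AddMonoidHom.fst _ _).ker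
      refine ⟨_, D.obj_preimage (v := 0) (A := A) (Or.inl fun w hw => hw) fun g hg => ?_⟩
      obtain ⟨z, rfl⟩ := D.exists_om (by_contra fun h' => h ⟨g, hg, h'⟩) (E.pow_eq_one g hg)
      exact ⟨(0, z), rfl, (D.pt_of_fst_eq_zero (w := (0, z)) 0 rfl).symm⟩

/-- Two groups with twisted coordinates over the same ring have equivalent Quillen categories. -/
theorem nonempty_equivalence [NeZero N] (D : TwistedCoords p M N e m θ G) {m' : ℕ} {G' : Type} [Group G']
    (D' : TwistedCoords p M N e m' θ G') : Nonempty (QuillenCat p G ≌ QuillenCat p G') := by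
  have h : D.functor.IsEquivalence :=
    { faithful := inferInstance, full := D.functor_full, essSurj := D.functor_essSurj }
  have h' : D'.functor.IsEquivalence :=
    { faithful := inferInstance, full := D'.functor_full, essSurj := D'.functor_essSurj }
  exact ⟨D.functor.asEquivalence.symm.trans D'.functor.asEquivalence⟩

end TwistedCoords

/-! ### Cyclotomic extensions of `ℤ_p` of prime power order -/

/-- Modulo p the cyclotomic polynomial of order p ^ (k + 1) is a power of X - 1. -/
theorem exists_cyclotomic_prime_pow_eq (p k : ℕ) [Fact p.Prime] :
    ∃ h : ℤ[X], (X - 1) ^ (p ^ (k + 1) - p ^ k) = cyclotomic (p ^ (k + 1)) ℤ + (p : ℤ[X]) * h := by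
  have h : (p : ℤ[X]) ∣ (X - 1) ^ (p ^ (k + 1) - p ^ k) - cyclotomic (p ^ (k + 1)) ℤ := by
    have hz : Polynomial.map (Int.castRingHom (ZMod p))
        ((X - 1) ^ (p ^ (k + 1) - p ^ k) - cyclotomic (p ^ (k + 1)) ℤ) = 0 := by
      have := cyclotomic_mul_prime_pow_eq (ZMod p) (p := p) (m := 1)
        (Fact.out : p.Prime).not_dvd_one (k := k + 1) (by omega)
      rw [mul_one, cyclotomic_one, Nat.add_sub_cancel] at this
      rw [Polynomial.map_sub, map_cyclotomic, this]
      simp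
    rw [← Polynomial.C_eq_natCast, C_dvd_iff_dvd_coeff]
    intro n
    have := congrArg (fun q => coeff q n) hz
    simp only [coeff_map, coeff_zero, eq_intCast] at this
    exact (ZMod.intCast_zmod_eq_zero_iff_dvd _ _).1 this
  obtain ⟨q, hq⟩ := h
  exact ⟨q, by rw [← hq]; ring⟩

namespace PadicCyc

variable (p k : ℕ) [Fact p.Prime]

theorem aeval_theta (N : ℕ) : aeval (theta p N) (cyclotomic N ℤ) = 0 := by
  have h : aeval (theta p N) (cyclotomic N ℤ_[p]) = 0 :=
    (AdjoinRoot.aeval_eq _).trans AdjoinRoot.mk_self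
  refine (aeval_map_algebraMap ℤ_[p] (theta p N) (cyclotomic N ℤ)).symm.trans ?_
  rwa [map_cyclotomic]

/-- Total ramification. In (X - 1) ^ e = Φ + p h, setting X = 1 gives 0 = p + p h(1), so h(1) = -1
and h(θ) is -1 modulo θ - 1. -/
theorem theta_sub_one_pow (N : ℕ) (hN : N = p ^ (k + 1)) : ∃ y : PadicCyc p N,
    (theta p N - 1) ^ (p ^ (k + 1) - p ^ k) = p * ((theta p N - 1) * y - 1) := by
  subst hN
  obtain ⟨h, hh⟩ := exists_cyclotomic_prime_pow_eq p k
  have h1 : h.eval 1 = -1 := by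
    have he := congrArg (eval 1) hh
    have hpos : p ^ (k + 1) - p ^ k ≠ 0 :=
      Nat.sub_ne_zero_of_lt (Nat.pow_lt_pow_right (Fact.out : p.Prime).one_lt k.lt_succ_self)
    rw [eval_pow, eval_sub, eval_X, eval_one, sub_self, zero_pow hpos, eval_add,
      eval_one_cyclotomic_prime_pow, eval_mul, eval_natCast] at he
    have hp : (p : ℤ) ≠ 0 := by exact_mod_cast (Fact.out : p.Prime).ne_zero
    exact mul_left_cancel₀ hp (by linarith)
  obtain ⟨q, hq⟩ := X_sub_C_dvd_sub_C_eval (a := 1) (p := h)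
  have hh' := congrArg (aeval (theta p (p ^ (k + 1)))) hh
  have hq' := congrArg (aeval (theta p (p ^ (k + 1)))) hq
  rw [h1] at hq'
  simp only [map_sub, map_mul, map_add, map_pow, aeval_X, map_one, aeval_theta, map_natCast,
    map_neg] at hh' hq'
  refine ⟨aeval (theta p (p ^ (k + 1))) q, ?_⟩
  rw [hh', zero_add, ← hq']
  ring

theorem prime_dvd (N : ℕ) (hN : N = p ^ (k + 1)) :
    (p : PadicCyc p N) ∣ (theta p N - 1) ^ (p ^ (k + 1) - p ^ k) := by
  obtain ⟨y, hy⟩ := theta_sub_one_pow p k N hN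
  exact ⟨_, hy⟩

theorem dvd_prime (N : ℕ) (hN : N = p ^ (k + 1)) :
    (theta p N - 1) ^ (p ^ (k + 1) - p ^ k) ∣ (p : PadicCyc p N) := by
  obtain ⟨y, hy⟩ := theta_sub_one_pow p k N hN
  -- Bootstrapping p = (θ - 1) p y - (θ - 1) ^ e raises the exponent by one at each step, so the
  -- invertibility of (θ - 1) y - 1 is never needed.
  suffices h : ∀ s ≤ p ^ (k + 1) - p ^ k, (theta p N - 1) ^ s ∣ (p : PadicCyc p N) from h _ le_rfl
  intro s
  induction s with
  | zero => simp
  | succ s ih =>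
    intro hs
    have hp : (p : PadicCyc p N) =
        (theta p N - 1) * (p * y) - (theta p N - 1) ^ (p ^ (k + 1) - p ^ k) := by
      rw [hy]; ring
    rw [hp, pow_succ']
    refine dvd_sub (mul_dvd_mul_left _ ((ih (by omega)).mul_right _)) ?_
    rw [← pow_succ']
    exact pow_dvd_pow _ hs

/-- θ - 1 divides p, and the ring is free over ℤ_p, hence without p-torsion; that it is a domain is
not used. -/
theorem regular (N : ℕ) (hN : N = p ^ (k + 1)) (x : PadicCyc p N) (hx : (theta p N - 1) * x = 0) :
    x = 0 := by
  have : Module.Free ℤ_[p] (PadicCyc p N) := (cyclotomic.monic N ℤ_[p]).free_adjoinRoot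
  have hpos : 0 < p ^ (k + 1) - p ^ k :=
    Nat.sub_pos_of_lt (Nat.pow_lt_pow_right (Fact.out : p.Prime).one_lt k.lt_succ_self)
  obtain ⟨r, hr⟩ := (dvd_pow_self (theta p N - 1) hpos.ne').trans (dvd_prime p k N hN)
  have h : (p : ℤ_[p]) • x = 0 := by
    rw [Algebra.smul_def, map_natCast, hr, mul_right_comm, hx, zero_mul]
  refine (smul_eq_zero.1 h).resolve_left ?_
  exact_mod_cast (Fact.out : p.Prime).ne_zero

theorem geom_sum (N : ℕ) (hN : N = p ^ (k + 1)) :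
    ∑ i ∈ Finset.range p, (theta p N ^ p ^ k) ^ i = 0 := by
  subst hN
  have h := aeval_theta p (p ^ (k + 1))
  rw [cyclotomic_prime_pow_eq_geom_sum (R := ℤ) (Fact.out : p.Prime)] at h
  simpa using h

theorem isRamifiedRoot (N : ℕ) (hN : N = p ^ (k + 1))
    (h1 : (theta p N - 1) ^ p ^ k ∣ theta p N ^ p ^ k - 1)
    (h2 : theta p N ^ p ^ k - 1 ∣ (theta p N - 1) ^ p ^ k) :
    IsRamifiedRoot p (p ^ k) N (p ^ (k + 1) - p ^ k) (theta p N) where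
  N_eq := by rw [hN, pow_succ']
  M_pos := pow_pos (Fact.out : p.Prime).pos k
  M_le_e := by
    have := Nat.mul_le_mul_left (p ^ k) (Fact.out : p.Prime).two_le
    rw [pow_succ]; omega
  pow_N := theta_pow p N
  regular := regular p k N hN
  prime_dvd := prime_dvd p k N hN
  dvd_prime := dvd_prime p k N hN
  dvd_omega := h1
  omega_dvd := h2
  geom_sum := geom_sum p k N hN

theorem isRamifiedRoot_prime : IsRamifiedRoot p 1 p (p - 1) (theta p p) := by
  simpa using isRamifiedRoot p 0 p (by simp) (by simp) (by simp)

end PadicCyc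

/-! ### Ramification for the ninth roots of unity -/

namespace Skeleton

theorem isRamifiedRoot_nine : IsRamifiedRoot 3 3 9 6 θ := by
  have h3 := PadicCyc.dvd_prime 3 1 9 (by norm_num)
  refine PadicCyc.isRamifiedRoot 3 1 9 (by norm_num) ?_ ?_
  · have : θ ^ 3 ^ 1 - 1 = (θ - 1) ^ 3 ^ 1 + 3 * (θ * (θ - 1)) := by ring
    rw [this]
    exact dvd_add dvd_rfl (((pow_dvd_pow _ (by norm_num)).trans h3).mul_right _)
  · have h : θ ^ 3 ^ 1 - 1 ∣ (3 : 𝒪) := ⟨-(θ ^ 3 + 2), by linear_combination theta_rel⟩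
    have : (θ - 1) ^ 3 ^ 1 = θ ^ 3 ^ 1 - 1 - 3 * (θ * (θ - 1)) := by ring
    rw [this]
    exact dvd_sub dvd_rfl (h.mul_right _)

end Skeleton

/-! ### The lower central quotients of `ℤ_p[θ] ⋊ C_p` -/

namespace MaxClassGroup

open scoped commutatorElement

variable {p : ℕ} [Fact p.Prime]

theorem toAdd_mul_left (g h : MaxClassGroup p) : (g * h).left.toAdd =
    g.left.toAdd + theta p p ^ g.right.toAdd.val * h.left.toAdd :=
  congrArg (fun v => g.left.toAdd + Multiplicative.toAdd v) (thetaAut_pow_apply p _ _)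

/-- The subgroup of the elements of `(θ - 1) ^ n ℤ_p[θ]`. -/
def translations (p : ℕ) [Fact p.Prime] (n : ℕ) : Subgroup (MaxClassGroup p) where
  carrier := {g | g.right = 1 ∧ (theta p p - 1) ^ n ∣ g.left.toAdd}
  one_mem' := ⟨rfl, dvd_zero _⟩
  mul_mem' := fun {g h} hg hh => ⟨by rw [SemidirectProduct.mul_right, hg.1, hh.1, one_mul], by
    rw [toAdd_mul_left]; exact dvd_add hg.2 (hh.2.mul_left _)⟩
  inv_mem' := fun {g} hg => ⟨by rw [SemidirectProduct.inv_right, hg.1, inv_one], by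
    have h := toAdd_mul_left g g⁻¹
    rw [mul_inv_cancel, hg.1, toAdd_one, ZMod.val_zero, pow_zero, one_mul] at h
    rw [← neg_eq_of_add_eq_zero_right h.symm]
    exact hg.2.neg_right⟩

theorem commutator_right (g h : MaxClassGroup p) : ⁅g, h⁆.right = 1 := by
  change SemidirectProduct.rightHom ⁅g, h⁆ = 1
  rw [map_commutatorElement, commutatorElement_eq_one_iff_mul_comm, mul_comm]

theorem toAdd_commutator_left (g h : MaxClassGroup p) : ⁅g, h⁆.left.toAdd =
    (theta p p ^ g.right.toAdd.val - 1) * h.left.toAdd -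
      (theta p p ^ h.right.toAdd.val - 1) * g.left.toAdd := by
  have h1 := commutator_right g h
  have h2 : ⁅g, h⁆ * (h * g) = g * h := by
    rw [commutatorElement_def]; group
  have h3 := congrArg (fun k => Multiplicative.toAdd (SemidirectProduct.left k)) h2
  simp only [toAdd_mul_left, h1, toAdd_one, ZMod.val_zero, pow_zero, one_mul] at h3
  linear_combination h3

/-- Commutation with τ is multiplication by θ - 1 up to sign. The index starts at 1 because term 0
is the whole group, which is not made of translations. -/
theorem lowerCentralSeries_eq (n : ℕ) :
    (⊤ : Subgroup (MaxClassGroup p)).lowerCentralSeries (n + 1) = translations p (n + 1) := by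
  have hdvd : ∀ k, theta p p - 1 ∣ theta p p ^ k - 1 := fun k => by
    simpa using sub_dvd_pow_sub_pow (theta p p) 1 k
  apply le_antisymm
  · induction n with
    | zero =>
      rw [Subgroup.lowerCentralSeries_succ, Subgroup.commutator_le]
      intro g _ h _
      refine ⟨commutator_right g h, ?_⟩
      rw [toAdd_commutator_left, zero_add, pow_one]
      exact dvd_sub ((hdvd _).mul_right _) ((hdvd _).mul_right _)
    | succ n ih =>
      rw [Subgroup.lowerCentralSeries_succ, Subgroup.commutator_le]
      intro g hg h _
      have hg' := ih hg
      refine ⟨commutator_right g h, ?_⟩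
      rw [toAdd_commutator_left, hg'.1, toAdd_one, ZMod.val_zero, pow_zero, sub_self, zero_mul,
        zero_sub, pow_succ']
      exact (mul_dvd_mul (hdvd _) hg'.2).neg_right
  · suffices h : ∀ n, translations p n ≤
        (⊤ : Subgroup (MaxClassGroup p)).lowerCentralSeries n from h _
    intro n
    induction n with
    | zero => exact le_top
    | succ n ih =>
      rintro g ⟨hg, y, hy⟩
      let t : MaxClassGroup p := SemidirectProduct.inr (.ofAdd 1)
      -- The sign compensates ⁅u, t⁆ = -(θ - 1) u.
      let u : MaxClassGroup p := SemidirectProduct.inl (.ofAdd (-((theta p p - 1) ^ n * y)))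
      have hu : u ∈ translations p n := ⟨rfl, (dvd_mul_right _ _).neg_right⟩
      have hgu : g = ⁅u, t⁆ := by
        refine SemidirectProduct.ext (Multiplicative.toAdd.injective ?_) 
          (hg.trans (commutator_right u t).symm)
        have hu2 : u.left.toAdd = -((theta p p - 1) ^ n * y) := rfl
        have ht : t.left.toAdd = 0 := rfl
        have ht' : t.right.toAdd.val = 1 := ZMod.val_one p
        rw [toAdd_commutator_left, hu2, ht, ht', hy]
        ring
      rw [hgu, Subgroup.lowerCentralSeries_succ]
      exact Subgroup.commutator_mem_commutator (ih hu) (Subgroup.mem_top _)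

theorem lowerCentralSeries_le_ker {i : ℕ} (hi : 2 ≤ i) :
    (⊤ : Subgroup (MaxClassGroup p)).lowerCentralSeries (i - 1) ≤
      (SemidirectProduct.rightHom : MaxClassGroup p →* _).ker := by
  obtain ⟨n, rfl⟩ : ∃ n, i = n + 2 := ⟨i - 2, by omega⟩
  intro g hg
  rw [show n + 2 - 1 = n + 1 by omega, lowerCentralSeries_eq] at hg
  exact hg.1

/-- The coordinates on `G_p / γ_i(G_p)`. -/
noncomputable def coords {i : ℕ} (hi : p + 1 ≤ i) :
    TwistedCoords p 1 p (p - 1) (i - 1) (theta p p) (MainLineQuotient p i) where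
  root := PadicCyc.isRamifiedRoot_prime p
  e_le := by omega
  two_M_le := by have := (Fact.out : p.Prime).two_le; omega
  c x := QuotientGroup.mk (SemidirectProduct.inl (.ofAdd x))
  τ := QuotientGroup.mk (SemidirectProduct.inr (.ofAdd 1))
  ρ := QuotientGroup.lift _ SemidirectProduct.rightHom
    (lowerCentralSeries_le_ker (by have := (Fact.out : p.Prime).two_le; omega))
  β := 0
  -- Since β = 0, any b with p - 1 ≤ b and 1 < b would do.
  b := p + 1
  e_le_b := by omega
  M_lt_b := by have := (Fact.out : p.Prime).two_le; omega
  c_eq {x y} := by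
    have hp := (Fact.out : p.Prime).two_le
    obtain ⟨n, rfl⟩ : ∃ n, i = n + 2 := ⟨i - 2, by omega⟩
    rw [QuotientGroup.eq, ← map_inv, ← map_mul, show n + 2 - 1 = n + 1 by omega,
      lowerCentralSeries_eq, dvd_sub_comm, sub_eq_neg_add y]
    exact ⟨fun h => h.2, fun h => ⟨rfl, h⟩⟩
  c_mul x y := by
    rw [← QuotientGroup.mk_mul, ← map_mul, AddMonoidHom.zero_apply, AddMonoidHom.zero_apply,
      add_zero]
    rfl
  exists_c {g} hg := by
    obtain ⟨g, rfl⟩ := QuotientGroup.mk_surjective g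
    exact ⟨g.left.toAdd, congrArg _ (SemidirectProduct.ext rfl hg)⟩
  ρ_c x := rfl
  ρ_τ := rfl
  τ_pow := by
    rw [← QuotientGroup.mk_pow, ← map_pow, ← ofAdd_nsmul, nsmul_one, CharP.cast_eq_zero,
      ofAdd_zero, map_one, QuotientGroup.mk_one]
  τ_c x := by
    rw [← QuotientGroup.mk_mul, ← QuotientGroup.mk_mul]
    refine congrArg _ (SemidirectProduct.ext (Multiplicative.toAdd.injective ?_) ?_)
    · rw [toAdd_mul_left, toAdd_mul_left]
      change 0 + theta p p ^ (1 : ZMod p).val * x = theta p p * x + _ * 0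
      rw [ZMod.val_one, pow_one, zero_add, mul_zero, add_zero]
    · rw [SemidirectProduct.mul_right, SemidirectProduct.mul_right, mul_comm]
      rfl
  β_dvd _ _ _ := dvd_zero _
  β_β _ _ _ := dvd_zero _
  β_omega _ _ _ := rfl

end MaxClassGroup

/-! ### The skeleton groups -/

namespace Skeleton

theorem γ₀_add_left (x y z : 𝒪) : γ₀ (x + y) z = γ₀ x z + γ₀ y z := by
  simp only [γ₀, map_add]; ring

theorem γ₀_add_right (x y z : 𝒪) : γ₀ x (y + z) = γ₀ x y + γ₀ x z := by
  simp only [γ₀, map_add]; ring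

/-- σ_2 and σ_{-1} agree on θ ^ 3, because 24 ≡ 6 modulo 9; so both terms of γ₀ acquire the same
factor and cancel. -/
theorem γ₀_omega (i k : ℕ) (x : 𝒪) : γ₀ ((θ ^ 3) ^ i * x) ((θ ^ 3) ^ k * x) = 0 := by
  have h9 : θ ^ 9 = 1 := theta_pow 3 9
  have h : (θ ^ 8) ^ 3 = (θ ^ 2) ^ 3 := by linear_combination (θ ^ 15 + θ ^ 6) * h9
  simp only [γ₀, map_mul, map_pow, σ_theta, h]
  ring

variable (d : Param)

/-- The factor `½ c (θ - 1) ^ (j - 3) ((θ + 1) (-θ⁻¹)) ^ (j - 3)` relating `γ₀` to the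
cocycle of the skeleton group in the coordinates of `T = (θ - 1) ^ (j - 3) 𝒪`. -/
noncomputable def Param.factor : 𝒪 :=
  half * d.c * ((θ + 1) * -θ ^ 8) ^ (d.j - 3)

/-- The cocycle `½ γ` in the coordinates of `T = (θ - 1) ^ (j - 3) 𝒪`. -/
noncomputable def Param.β : 𝒪 →+ 𝒪 →+ 𝒪 :=
  AddMonoidHom.mk' (fun x => AddMonoidHom.mk'
    (fun y => d.factor * ((θ - 1) ^ (d.j - 3) * γ₀ x y))
    (fun y z => by rw [γ₀_add_right]; ring))
    (fun x y => by
      ext z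
      change d.factor * ((θ - 1) ^ (d.j - 3) * γ₀ (x + y) z) =
        d.factor * ((θ - 1) ^ (d.j - 3) * γ₀ x z) + d.factor * ((θ - 1) ^ (d.j - 3) * γ₀ y z)
      rw [γ₀_add_left]; ring)

theorem β_apply (x y : 𝒪) : d.β x y = d.factor * ((θ - 1) ^ (d.j - 3) * γ₀ x y) := rfl

/-- σ_2 and σ_{-1} multiply θ - 1 by θ + 1 and -θ ^ 8. Scaling both arguments yields (θ - 1) ^ (j -
3) twice: one copy is the coordinate scale of T, the other stays in the cocycle. -/
theorem half_γ_eq (x y : 𝒪) :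
    half * d.γ ((θ - 1) ^ (d.j - 3) * x) ((θ - 1) ^ (d.j - 3) * y) =
      (θ - 1) ^ (d.j - 3) * d.β x y := by
  rw [Param.γ, γ₀_expand, β_apply, Param.factor, γ₀, mul_pow]
  ring

theorem mem_p_pow_iff {n : ℕ} {x : 𝒪} : x ∈ 𝔭 ^ n ↔ (θ - 1) ^ n ∣ x := mem_pow_iff

/-- The element of `T` with coordinate `x`. -/
noncomputable def scale (x : 𝒪) : d.T 0 :=
  ⟨(θ - 1) ^ (d.j - 3) * x, mem_p_pow_iff.2 (dvd_mul_right _ _)⟩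

theorem cls_scale_eq {x y : 𝒪} :
    TwistedT.cls (scale d x) = TwistedT.cls (scale d y) ↔ (θ - 1) ^ d.m ∣ x - y := by
  rw [TwistedT.cls_eq, mem_p_pow_iff, scale, scale, ← mul_sub]
  exact ⟨isRamifiedRoot_nine.pow_dvd_cancel _ _, fun h => by
    rw [pow_add]; exact mul_dvd_mul_left _ h⟩

theorem cls_scale_mul (x y : 𝒪) : TwistedT.cls (scale d x) * TwistedT.cls (scale d y) =
    TwistedT.cls (scale d (x + y + d.β x y)) := by
  rw [TwistedT.cls_mul]
  congr 1
  ext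
  change (θ - 1) ^ (d.j - 3) * x + (θ - 1) ^ (d.j - 3) * y +
    half * d.γ ((θ - 1) ^ (d.j - 3) * x) ((θ - 1) ^ (d.j - 3) * y) =
      (θ - 1) ^ (d.j - 3) * (x + y + d.β x y)
  rw [half_γ_eq]; ring

theorem exists_cls_scale (a : TwistedT d) : ∃ x, a = TwistedT.cls (scale d x) := by
  obtain ⟨⟨x, hx⟩, rfl⟩ := TwistedT.cls_surj a
  obtain ⟨u, rfl⟩ := mem_pow_iff.1 hx
  exact ⟨u, rfl⟩

/-- γ₀ gains two powers of θ - 1 and the scaling j - 3, in total j - 1. The bound j ≥ 7 is exactly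
what makes this at least e = 6. -/
theorem pow_dvd_β (s : ℕ) (x y : 𝒪) :
    (θ - 1) ^ (s + (d.j - 1)) ∣ d.β ((θ - 1) ^ s * x) y := by
  have hj := d.seven_le
  have h := mem_p_pow_iff.1 (γ₀_mem (mem_p_pow_iff.2 (dvd_mul_right ((θ - 1) ^ s) x))
    (show y ∈ 𝔭 ^ 0 by simp))
  rw [β_apply, show s + (d.j - 1) = (d.j - 3) + (s + 0 + 2) by omega, pow_add]
  exact (mul_dvd_mul_left _ h).mul_left _

/-- The inner β lies in 𝔭 ^ j, since exponents congruent modulo 3 gain three powers. The outer one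
reaches 2j - 1, or 2j when 3 ∣ j gives the extra gain again: precisely the upper bound on m. -/
theorem pow_dvd_β_β (x y z : 𝒪) : (θ - 1) ^ d.m ∣ d.β (d.β x y) z := by
  have hj := d.seven_le
  have hm := d.m_le
  have hxy : d.β x y ∈ 𝔭 ^ d.j := by
    have h := mem_p_pow_iff.1 (γ₀_mem' rfl (show x ∈ 𝔭 ^ 0 by simp) (show y ∈ 𝔭 ^ 0 by simp))
    rw [mem_p_pow_iff, β_apply]
    conv_lhs => rw [show d.j = (d.j - 3) + (0 + 0 + 3) by omega, pow_add]
    exact (mul_dvd_mul_left _ h).mul_left _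
  have h0 : z ∈ 𝔭 ^ 0 := by simp
  rw [β_apply]
  refine Dvd.dvd.mul_left ?_ _
  by_cases h3 : 3 ∣ d.j
  · rw [if_pos h3] at hm
    have h := mem_p_pow_iff.1 (γ₀_mem' (show d.j % 3 = 0 % 3 by omega) hxy h0)
    refine (pow_dvd_pow _ (show d.m ≤ (d.j - 3) + (d.j + 0 + 3) by omega)).trans ?_
    rw [pow_add]
    exact mul_dvd_mul_left _ h
  · rw [if_neg h3] at hm
    have h := mem_p_pow_iff.1 (γ₀_mem hxy h0)
    refine (pow_dvd_pow _ (show d.m ≤ (d.j - 3) + (d.j + 0 + 2) by omega)).trans ?_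
    rw [pow_add]
    exact mul_dvd_mul_left _ h

/-- The coordinates on a skeleton group. -/
noncomputable def coords : TwistedCoords 3 3 9 6 d.m θ (SkeletonGroup d) where
  root := isRamifiedRoot_nine
  e_le := by have := d.seven_le; have := d.j_le; omega
  two_M_le := by have := d.seven_le; have := d.j_le; omega
  c x := SemidirectProduct.inl (TwistedT.cls (scale d x))
  τ := SemidirectProduct.inr (.ofAdd 1)
  ρ := SemidirectProduct.rightHom
  β := d.β
  b := d.j - 1
  e_le_b := by have := d.seven_le; omega
  M_lt_b := by have := d.seven_le; omega
  c_eq := SemidirectProduct.inl_injective.eq_iff.trans (cls_scale_eq d)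
  c_mul x y := by rw [← map_mul, cls_scale_mul]
  exists_c {g} hg := by
    obtain ⟨x, hx⟩ := exists_cls_scale d g.left
    exact ⟨x, SemidirectProduct.ext hx hg⟩
  ρ_c _ := rfl
  ρ_τ := rfl
  τ_pow := by
    rw [← map_pow, ← ofAdd_nsmul, nsmul_one, CharP.cast_eq_zero, ofAdd_zero, map_one]
  τ_c x := by
    rw [← mul_inv_eq_iff_eq_mul, ← map_inv, ← SemidirectProduct.inl_aut]
    congr 1
    change (TwistedT.thetaAut d ^ 1) (TwistedT.cls (scale d x)) = _
    rw [pow_one]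
    change TwistedT.cls (θ ^ 1 • scale d x) = _
    congr 1
    ext
    change θ ^ 1 * ((θ - 1) ^ (d.j - 3) * x) = (θ - 1) ^ (d.j - 3) * (θ * x)
    ring
  β_dvd := pow_dvd_β d
  β_β := pow_dvd_β_β d
  β_omega i k x := by rw [β_apply, γ₀_omega, mul_zero, mul_zero]

end Skeleton

/-- Within each family the ring and p, M, N, e, θ are fixed, so any two members share one model. -/
theorem mainTheorem1 :
    (∀ (p : ℕ) [Fact p.Prime] (i i' : ℕ), p + 1 ≤ i → p + 1 ≤ i' →
      Nonempty (QuillenCat p (MainLineQuotient p i) ≌ QuillenCat p (MainLineQuotient p i'))) ∧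
    (∀ d d' : Skeleton.Param,
      Nonempty (QuillenCat 3 (Skeleton.SkeletonGroup d) ≌
        QuillenCat 3 (Skeleton.SkeletonGroup d'))) :=
  ⟨fun _ _ _ _ hi hi' =>
    (MaxClassGroup.coords hi).nonempty_equivalence (MaxClassGroup.coords hi'),
  fun d d' => (Skeleton.coords d).nonempty_equivalence (Skeleton.coords d')⟩
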